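/- A UHF-algebra is an infinite dimensional unital $C^*$-algebra that is the norm closure of the union of an increasing sequence of unital $^*$-subalgebras (all containing the unit of the algebra), each isomorphic to a full matrix algebra $M_k(\mathbb{C})$. A unital embedding (injective unital $^*$-homomorphism) $\iota \colon B \to A$ of unital $C^*$-algebras is called $C^*$-irreducible if every intermediate $C^*$-algebra $\iota(B) \subseteq D \subseteq A$ is simple (that is, non-zero and without non-trivial closed two-sided ideals). Two $^*$-subalgebras $C_1, C_2$ of a $C^*$-algebra $A$ are called everywhere non-orthogonal if $c_1c_2 \neq 0$ for all non-zero elements $c_1 \in C_1$ and $c_2 \in C_2$ that are positive in $A$. Theorem. Let $A$ and $B$ be UHF-algebras such that $B$ admits a unital embedding into $A$. Then there exists a $C^*$-irreducible unital embedding $\iota \colon B \to A$. Moreover, $\iota$ can be chosen such that there are strictly increasing sequences $A_1 \subset A_2 \subset \cdots$ and $B_1 \subset B_2 \subset \cdots$ of unital $^*$-subalgebras of $A$ and of $B$, respectively, each isomorphic to a full matrix algebra over $\mathbb{C}$, with $\bigcup_n A_n$ dense in $A$ and $\bigcup_n B_n$ dense in $B$, such that $\iota(B_n) \subseteq A_n$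 and such that $A_n$ and $A_{n+1} \cap \iota(B_{n+1})'$ are everywhere non-orthogonal, for all $n \geq 1$. -/

import Mathlib

section UHF

/-- A (unital) C*-algebra `D` is *simple* if it is non-zero and has no closed two-sided ideals
other than `0` and `D`. -/
def IsSimpleCStar (D : Type*) [Ring D] [TopologicalSpace D] : Prop :=
  Nontrivial D ∧ ∀ I : TwoSidedIdeal D, IsClosed (I : Set D) → I = ⊥ ∨ I = ⊤

variable {A B : Type*} [CStarAlgebra A] [CStarAlgebra B]

/-- A strictly increasing sequence of unital *-subalgebras of `A`, each of them *-isomorphic to a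
full matrix algebra over `ℂ`, with dense union in `A`. (A `StarSubalgebra` always contains the
unit of the ambient algebra.) -/
structure IsMatrixTower (M : ℕ → StarSubalgebra ℂ A) : Prop where
  strictMono : StrictMono M
  matrix : ∀ n, ∃ k : ℕ, Nonempty (M n ≃⋆ₐ[ℂ] Matrix (Fin k) (Fin k) ℂ)
  dense : Dense (⋃ n, (M n : Set A))

variable (A) in
/-- `A` is an (infinite dimensional) UHF-algebra: the inductive limit of a sequence of full matrix
algebras of increasing size with unital connecting maps. -/
def IsUHF : Prop := ∃ M : ℕ → StarSubalgebra ℂ A, IsMatrixTower M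

/-- A unital *-homomorphism `ι : B → A` is a *C*-irreducible embedding* if it is injective and
every intermediate C*-algebra `ι(B) ⊆ D ⊆ A` is simple; in particular `A` and
`ι(B) ≅ B` are simple. -/
structure IsCStarIrreducible (ι : B →⋆ₐ[ℂ] A) : Prop where
  injective : Function.Injective ι
  simple : ∀ D : StarSubalgebra ℂ A, IsClosed (D : Set A) → ι.range ≤ D → IsSimpleCStar D

/-- Two *-subalgebras of `A` are *everywhere non-orthogonal* if no non-zero positive element of the
first is orthogonal to a non-zero positive element of the second. -/
def EverywhereNonOrthogonal [PartialOrder A] [StarOrderedRing A]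
    (C₁ C₂ : StarSubalgebra ℂ A) : Prop :=
  ∀ a ∈ C₁, ∀ b ∈ C₂, 0 ≤ a → 0 ≤ b → a ≠ 0 → b ≠ 0 → a * b ≠ 0

end UHF

/-! The mechanism is averaging. For matrix units `e_ij` of a matrix algebra of size `k`, the map `x
↦ k⁻¹ ∑ e_jc x e_cj` preserves closed ideals of any algebra containing the units. If, as the units
run through `ι(B)`, these averages can be brought arbitrarily close to `τ(y*y) 1` for each `y`, with
`τ` the trace of `A`, then a closed ideal of an intermediate algebra containing `y ≠ 0` contains
`τ(y*y) 1`. The trace is faithful, so the ideal is everything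
(`isSimpleCStar_of_norm_matrixAverage_sub_lt`).

The embedding is built along subsequences of the two towers (`exists_extension_step`). In suitable
coordinates a stage `M_β → M_α` is `x ↦ x ⊗ 1_δ`, the next stage of `B` is `M_β ⊗ M_κ`, and that of
`A` is `M_β ⊗ M_δ ⊗ M_l`. An extension of the map amounts to a bijection `δ × l ≃ κ × d`. It is
chosen so that, for all but fewer than `|δ|` indices `c` in `κ`, the coordinate in `δ` is constant
on the fibre over `c` (`exists_prod_equiv_prod_const_fst`). The new diagonal matrix unit at such an
index compresses the old stage `M_α` to scalars, namely to diagonal entries. The bad proportion is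
at most `|α| / |β'|`, which is made small by going far along the tower of `B`, so averages of old
elements are nearly scalar (`exists_norm_matrixAverage_sub_le`).

Non-orthogonality has the same source. A non-zero positive `x` has a non-zero diagonal entry, which
some good index `c` detects: `e_cc x e_cc = y e_cc` with `y ≠ 0`. If `b` commutes with the units and
`x b = 0`, then `e_cc b = 0`, hence `b = 0`.

The steps require the sizes in the tower of `B` to divide those in the tower of `A` eventually; this
follows from traces of projections (`IsMatrixTower.exists_card_dvd`). -/

/-! ### Homomorphisms between matrix algebras -/

open Matrix in
/-- An orthogonal projection matrix is `V * Vᴴ` for an isometry `V`. -/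
theorem Matrix.exists_isometry_of_projection {n : Type} [Fintype n] [DecidableEq n]
    {P : Matrix n n ℂ} (hP : P.IsHermitian) (hPP : P * P = P) :
    ∃ (l : Type) (_ : Fintype l) (_ : DecidableEq l) (V : Matrix n l ℂ),
      V * Vᴴ = P ∧ Vᴴ * V = 1 := by
  classical
  set U : Matrix n n ℂ := (hP.eigenvectorUnitary : Matrix n n ℂ) with hU
  have hUU : Uᴴ * U = 1 := by
    have := hP.eigenvectorUnitary.2
    exact (Matrix.mem_unitaryGroup_iff'.mp this)
  set D : Matrix n n ℂ := diagonal (fun i => (hP.eigenvalues i : ℂ)) with hD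
  have hspec : P = U * D * Uᴴ := by
    have := hP.spectral_theorem
    rw [Unitary.conjStarAlgAut_apply] at this
    exact this
  have hDD : D * D = D := by
    have h1 : Uᴴ * P * U = D := by
      rw [hspec]
      calc Uᴴ * (U * D * Uᴴ) * U = (Uᴴ * U) * D * (Uᴴ * U) := by simp only [Matrix.mul_assoc]
        _ = D := by rw [hUU]; simp
    have h2 : Uᴴ * (P * P) * U = D * D := by
      rw [hspec]
      calc Uᴴ * ((U * D * Uᴴ) * (U * D * Uᴴ)) * U
          = (Uᴴ * U) * D * (Uᴴ * U) * D * (Uᴴ * U) := by simp only [Matrix.mul_assoc]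
        _ = D * D := by rw [hUU]; simp
    rw [← h2, hPP, h1]
  have hev : ∀ i, (hP.eigenvalues i : ℂ) = if hP.eigenvalues i ≠ 0 then 1 else 0 := by
    intro i
    have := congrFun (congrFun hDD i) i
    simp only [hD, diagonal_mul_diagonal, diagonal_apply_eq] at this
    split_ifs with h
    · have h' : (hP.eigenvalues i : ℂ) ≠ 0 := by exact_mod_cast h
      exact mul_right_cancel₀ h' (by rw [this, one_mul])
    · push Not at h; simp [h]
  -- Idempotency makes every eigenvalue 0 or 1; the columns of the isometry are the eigenvectors
  -- with eigenvalue 1.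
  refine ⟨{i // hP.eigenvalues i ≠ 0}, inferInstance, inferInstance,
    U.submatrix id Subtype.val, ?_, ?_⟩
  · ext a b
    have hab := congrFun (congrFun hspec a) b
    rw [Matrix.mul_apply] at hab
    rw [hab, Matrix.mul_apply]
    simp only [hD, mul_diagonal, submatrix_apply, id, conjTranspose_apply]
    rw [← Finset.sum_subtype (Finset.univ.filter fun i => hP.eigenvalues i ≠ 0) (by simp)
      (fun i => U a i * star (U b i)), Finset.sum_filter]
    refine Finset.sum_congr rfl fun i _ => ?_
    rw [hev i]
    split_ifs <;> simp
  · ext i j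
    have := congrFun (congrFun hUU i.1) j.1
    rw [Matrix.mul_apply] at this ⊢
    simpa [Matrix.one_apply, Subtype.ext_iff] using this

open Matrix in
/-- Conjugation by a (rectangular) unitary matrix as a star-algebra equivalence. -/
noncomputable def Matrix.conjUnitaryEquiv {m n : Type} [Fintype m] [DecidableEq m] [Fintype n]
    [DecidableEq n] (W : Matrix n m ℂ) (h₁ : Wᴴ * W = 1) (h₂ : W * Wᴴ = 1) :
    Matrix m m ℂ ≃⋆ₐ[ℂ] Matrix n n ℂ :=
  StarAlgEquiv.ofAlgEquiv
    (AlgEquiv.ofAlgHom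
      (AlgHom.ofLinearMap
        { toFun := fun X => W * X * Wᴴ
          map_add' := fun X Y => by simp [Matrix.mul_add, Matrix.add_mul]
          map_smul' := fun c X => by simp } (by simpa using h₂)
        (fun X Y => by
          change W * (X * Y) * Wᴴ = (W * X * Wᴴ) * (W * Y * Wᴴ)
          calc W * (X * Y) * Wᴴ = W * X * (1 : Matrix m m ℂ) * Y * Wᴴ := by simp [Matrix.mul_assoc]
            _ = _ := by rw [← h₁]; simp only [Matrix.mul_assoc]))
      (AlgHom.ofLinearMap
        { toFun := fun X => Wᴴ * X * W
          map_add' := fun X Y => by simp [Matrix.mul_add, Matrix.add_mul]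
          map_smul' := fun c X => by simp } (by simpa using h₁)
        (fun X Y => by
          change Wᴴ * (X * Y) * W = (Wᴴ * X * W) * (Wᴴ * Y * W)
          calc Wᴴ * (X * Y) * W = Wᴴ * X * (1 : Matrix n n ℂ) * Y * W := by simp [Matrix.mul_assoc]
            _ = _ := by rw [← h₂]; simp only [Matrix.mul_assoc]))
      (by
        ext1 X
        change W * (Wᴴ * X * W) * Wᴴ = X
        calc _ = (W * Wᴴ) * X * (W * Wᴴ) := by simp only [Matrix.mul_assoc]
          _ = X := by rw [h₂]; simp)
      (by
        ext1 X
        change Wᴴ * (W * X * Wᴴ) * W = X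
        calc _ = (Wᴴ * W) * X * (Wᴴ * W) := by simp only [Matrix.mul_assoc]
          _ = X := by rw [h₁]; simp))
    (fun X => by
      change W * Xᴴ * Wᴴ = (W * X * Wᴴ)ᴴ
      simp [Matrix.mul_assoc])

open Matrix in
theorem Matrix.conjUnitaryEquiv_apply {m n : Type} [Fintype m] [DecidableEq m] [Fintype n]
    [DecidableEq n] (W : Matrix n m ℂ) (h₁ : Wᴴ * W = 1) (h₂ : W * Wᴴ = 1) (X : Matrix m m ℂ) :
    conjUnitaryEquiv W h₁ h₂ X = W * X * Wᴴ := rfl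

open Matrix Kronecker in
/-- Up to a unitary change of coordinates, a unital star homomorphism between full matrix
algebras is an amplification `x ↦ x ⊗ 1`. -/
theorem Matrix.exists_equiv_amplification {m n : Type} [Fintype m] [DecidableEq m] [Nonempty m]
    [Fintype n] [DecidableEq n] (f : Matrix m m ℂ →⋆ₐ[ℂ] Matrix n n ℂ) :
    ∃ (l : Type) (_ : Fintype l) (_ : DecidableEq l)
      (e : Matrix (m × l) (m × l) ℂ ≃⋆ₐ[ℂ] Matrix n n ℂ),
      ∀ x, e (x ⊗ₖ (1 : Matrix l l ℂ)) = f x := by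
  obtain ⟨o⟩ := ‹Nonempty m›
  have hst : ∀ i j, (f (single i j 1))ᴴ = f (single j i 1) := by
    intro i j
    rw [← star_eq_conjTranspose, ← map_star, star_eq_conjTranspose, conjTranspose_single,
      star_one]
  have hmul : ∀ i j k, f (single i j 1) * f (single j k 1) = f (single i k 1) := by
    intro i j k
    rw [← map_mul, single_mul_single_same, one_mul]
  have hmul0 : ∀ i j j' k, j ≠ j' → f (single i j 1) * f (single j' k 1) = 0 := by
    intro i j j' k h
    rw [← map_mul, single_mul_single_of_ne _ _ _ _ h, map_zero]
  have hone : ∑ i, f (single i i 1) = 1 := by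
    rw [← map_sum, sum_single_one, map_one]
  obtain ⟨l, _, _, V, hV₁, hV₂⟩ := exists_isometry_of_projection
    (P := f (single o o 1)) (hst o o) (hmul o o o)
  -- The columns of `V` are an orthonormal basis of the range of `f(e_oo)`, and `f(e_io)` carries it
  -- to one of the range of `f(e_ii)`. Together these bases form the unitary `W`.
  set W : Matrix n (m × l) ℂ := Matrix.of fun a p => (f (single p.1 o 1) * V) a p.2 with hW
  have hPV : f (single o o 1) * V = V := by
    rw [← hV₁, Matrix.mul_assoc, hV₂, Matrix.mul_one]
  have hW₁ : Wᴴ * W = 1 := by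
    ext p q
    have h1 : (Wᴴ * W) p q
        = ((f (single p.1 o 1) * V)ᴴ * (f (single q.1 o 1) * V)) p.2 q.2 := by
      simp only [Matrix.mul_apply (M := Wᴴ), conjTranspose_apply]
      rfl
    rw [h1, conjTranspose_mul, hst, Matrix.mul_assoc, ← Matrix.mul_assoc (f _) (f _) V]
    by_cases h : p.1 = q.1
    · rw [h, hmul, hPV, hV₂]
      simp [Matrix.one_apply, Prod.ext_iff, h]
    · rw [hmul0 _ _ _ _ h]
      simp [Prod.ext_iff, h]
  have key : ∀ x : Matrix m m ℂ, W * (x ⊗ₖ (1 : Matrix l l ℂ)) = f x * W := by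
    intro x
    induction x using Matrix.induction_on' with
    | h_zero => simp
    | h_add p q hp hq => rw [add_kronecker, Matrix.mul_add, hp, hq, map_add, Matrix.add_mul]
    | h_std_basis i j c =>
      have hc : (single i j c : Matrix m m ℂ) = c • single i j 1 := by simp
      rw [hc, smul_kronecker, map_smul, Matrix.mul_smul, Matrix.smul_mul]
      congr 1
      ext a p
      have h1 : (f (single i j 1) * W) a p
          = (f (single i j 1) * (f (single p.1 o 1) * V)) a p.2 := by
        simp only [Matrix.mul_apply (N := W)]
        rfl
      rw [h1, ← Matrix.mul_assoc, Matrix.mul_apply, Fintype.sum_prod_type]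
      by_cases h : j = p.1
      · rw [← h, hmul]
        simp [kroneckerMap_apply, Matrix.one_apply, hW, single_apply, h.symm]
      · rw [hmul0 _ _ _ _ h]
        simp [kroneckerMap_apply, Matrix.one_apply, h]
  have hW₂ : W * Wᴴ = 1 := by
    have h1 : W * Wᴴ = ∑ i, f (single i o 1) * V * (f (single i o 1) * V)ᴴ := by
      ext a b
      rw [Matrix.mul_apply, Fintype.sum_prod_type, Matrix.sum_apply]
      rfl
    rw [h1, ← hone]
    refine Finset.sum_congr rfl fun i _ => ?_
    rw [conjTranspose_mul, hst, Matrix.mul_assoc, ← Matrix.mul_assoc V, hV₁, hmul, hmul]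
  refine ⟨l, inferInstance, inferInstance, conjUnitaryEquiv W hW₁ hW₂, fun x => ?_⟩
  rw [conjUnitaryEquiv_apply, key, Matrix.mul_assoc, hW₂, Matrix.mul_one]

/-! ### Rearranging tensor factors -/

/-- If `|δ| |l| = |κ| d`, then `δ × l` can be rearranged as `κ × Fin d` so that all but fewer than
`|δ|` of the fibres over `κ` have constant first coordinate. -/
theorem exists_prod_equiv_prod_const_fst {δ l κ : Type} [Fintype δ] [Nonempty δ] [Fintype l]
    [Fintype κ] [DecidableEq κ] (d : ℕ)
    (h : Fintype.card δ * Fintype.card l = Fintype.card κ * d) :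
    ∃ (e : δ × l ≃ κ × Fin d) (bad : Finset κ) (p : κ → δ),
      bad.card < Fintype.card δ ∧ (∀ c ∉ bad, ∀ u, (e.symm (c, u)).1 = p c) ∧
      (Fintype.card δ ≤ Fintype.card κ → ∀ i, ∃ c ∉ bad, p c = i) := by
  classical
  -- Each `i` in `δ` receives `q` full fibres of size `d`, cut from `{i} × l`. The remaining `r <
  -- |δ|` fibres are filled arbitrarily with what is left, since `|δ| s = r d`.
  set q := Fintype.card κ / Fintype.card δ with hq
  set r := Fintype.card κ % Fintype.card δ with hr
  have hδ : 0 < Fintype.card δ := Fintype.card_pos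
  have hκ : Fintype.card δ * q + r = Fintype.card κ := Nat.div_add_mod _ _
  have hl : q * d ≤ Fintype.card l := by
    refine Nat.le_of_mul_le_mul_left ?_ hδ
    rw [h, ← hκ]
    nlinarith
  set s := Fintype.card l - q * d with hs
  have hls : q * d + s = Fintype.card l := by omega
  let eκ : (δ × Fin q) ⊕ Fin r ≃ κ := Fintype.equivOfCardEq (by simp [hκ])
  let el : l ≃ (Fin q × Fin d) ⊕ Fin s := Fintype.equivOfCardEq (by simp [hls])
  let e0 : δ × Fin s ≃ Fin r × Fin d := Fintype.equivOfCardEq (by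
    have h' := h
    rw [← hκ, ← hls] at h'
    simp only [Fintype.card_prod, Fintype.card_fin]
    nlinarith)
  let e : δ × l ≃ κ × Fin d :=
    (Equiv.prodCongr (Equiv.refl δ) el).trans <| (Equiv.prodSumDistrib δ _ _).trans <|
      (Equiv.sumCongr (Equiv.prodAssoc δ (Fin q) (Fin d)).symm e0).trans <|
      (Equiv.sumProdDistrib (δ × Fin q) (Fin r) (Fin d)).symm.trans <|
      Equiv.prodCongr eκ (Equiv.refl _)
  obtain ⟨o⟩ := ‹Nonempty δ›
  refine ⟨e, Finset.univ.image (fun i : Fin r => eκ (Sum.inr i)),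
    fun c => Sum.elim (fun x => x.1) (fun _ => o) (eκ.symm c), ?_, ?_, ?_⟩
  · refine Finset.card_image_le.trans_lt ?_
    simpa using Nat.mod_lt _ hδ
  · intro c hc u
    obtain ⟨x, rfl⟩ := eκ.surjective c
    rcases x with x | i
    · simp [e]
    · exact absurd (Finset.mem_image_of_mem _ (Finset.mem_univ i)) hc
  · intro hle i
    have hq0 : 0 < q := Nat.div_pos hle hδ
    refine ⟨eκ (Sum.inl (i, ⟨0, hq0⟩)), by simp, by simp⟩

open Matrix Kronecker in
/-- Amplification followed by a change of index set, as a unital star homomorphism. -/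
noncomputable def Matrix.amplifyReindex {m n l : Type} [Fintype m] [DecidableEq m] [Fintype n]
    [DecidableEq n] [Fintype l] [DecidableEq l] (g : n ≃ m × l) :
    Matrix m m ℂ →⋆ₐ[ℂ] Matrix n n ℂ where
  toFun X := (X ⊗ₖ (1 : Matrix l l ℂ)).submatrix g g
  map_one' := by rw [one_kronecker_one, submatrix_one_equiv]
  map_mul' X Y := by
    rw [submatrix_mul_equiv, ← mul_kronecker_mul, Matrix.one_mul]
  map_zero' := by rw [zero_kronecker, submatrix_zero]; rfl
  map_add' X Y := by rw [add_kronecker, submatrix_add]; rfl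
  commutes' c := by
    rw [Algebra.algebraMap_eq_smul_one, Algebra.algebraMap_eq_smul_one, smul_kronecker,
      one_kronecker_one]
    change c • (1 : Matrix (m × l) (m × l) ℂ).submatrix g g = c • 1
    rw [submatrix_one_equiv]
  map_star' X := by
    simp only [star_eq_conjTranspose, conjTranspose_submatrix, conjTranspose_kronecker,
      conjTranspose_one]

open Matrix Kronecker in
theorem Matrix.amplifyReindex_apply {m n l : Type} [Fintype m] [DecidableEq m] [Fintype n]
    [DecidableEq n] [Fintype l] [DecidableEq l] (g : n ≃ m × l) (X : Matrix m m ℂ) (a b : n) :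
    amplifyReindex g X a b = X (g a).1 (g b).1 * (1 : Matrix l l ℂ) (g a).2 (g b).2 := rfl

/-- The bijection `(β × δ) × l ≃ (β × κ) × μ` induced by `δ × l ≃ κ × μ`. -/
def Equiv.prodProdCongr {β δ l κ μ : Type} (e : δ × l ≃ κ × μ) :
    (β × δ) × l ≃ (β × κ) × μ :=
  (Equiv.prodAssoc β δ l).trans <| (Equiv.prodCongr (Equiv.refl β) e).trans
    (Equiv.prodAssoc β κ μ).symm

open Matrix Kronecker in
-- The bijection leaves the `β` coordinate alone, so the identity on `κ × μ` becomes the identity on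
-- `δ × l`. This makes the new embedding extend the old one.
theorem Matrix.amplifyReindex_kronecker_one {β δ l κ μ : Type} [Fintype β] [DecidableEq β]
    [Fintype δ] [DecidableEq δ] [Fintype l] [DecidableEq l] [Fintype κ] [DecidableEq κ]
    [Fintype μ] [DecidableEq μ] (e : δ × l ≃ κ × μ) (x : Matrix β β ℂ) :
    amplifyReindex (Equiv.prodProdCongr e) (x ⊗ₖ (1 : Matrix κ κ ℂ))
      = (x ⊗ₖ (1 : Matrix δ δ ℂ)) ⊗ₖ (1 : Matrix l l ℂ) := by
  ext ⟨⟨s, i⟩, u⟩ ⟨⟨t, j⟩, v⟩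
  have h : (e (i, u)).1 = (e (j, v)).1 ∧ (e (i, u)).2 = (e (j, v)).2 ↔ i = j ∧ u = v := by
    rw [← Prod.ext_iff, e.injective.eq_iff, Prod.mk.injEq]
  simp only [amplifyReindex_apply, Equiv.prodProdCongr, kroneckerMap_apply, Matrix.one_apply,
    Equiv.trans_apply, Equiv.prodAssoc_apply, Equiv.prodCongr_apply, Prod.map, Equiv.refl_apply,
    Equiv.prodAssoc_symm_apply, ← ite_and, mul_ite, mul_one, mul_zero]
  exact if_congr (and_comm.trans (h.trans and_comm)) rfl rfl

open Matrix Kronecker in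
-- The image of the diagonal unit is the coordinate projection onto the indices with `β` coordinate
-- `s` and `κ` coordinate `c`. Their `δ` coordinate is always `p`, so a single diagonal entry of `Y`
-- survives.
theorem Matrix.amplifyReindex_compress {β δ l κ μ : Type} [Fintype β] [DecidableEq β]
    [Fintype δ] [DecidableEq δ] [Fintype l] [DecidableEq l] [Fintype κ] [DecidableEq κ]
    [Fintype μ] [DecidableEq μ] (e : δ × l ≃ κ × μ) (s : β) {c : κ} {p : δ}
    (hc : ∀ u, (e.symm (c, u)).1 = p) (Y : Matrix (β × δ) (β × δ) ℂ) :
    amplifyReindex (Equiv.prodProdCongr e) (single (s, c) (s, c) 1) * (Y ⊗ₖ (1 : Matrix l l ℂ)) *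
      amplifyReindex (Equiv.prodProdCongr e) (single (s, c) (s, c) 1)
      = Y (s, p) (s, p) • amplifyReindex (Equiv.prodProdCongr e) (single (s, c) (s, c) 1) := by
  have hD : amplifyReindex (Equiv.prodProdCongr e) (single (s, c) (s, c) 1)
      = diagonal (fun a : (β × δ) × l => if a.1.1 = s ∧ (e (a.1.2, a.2)).1 = c then 1 else 0) := by
    ext ⟨⟨t, i⟩, u⟩ ⟨⟨t', j⟩, v⟩
    have h : (e (i, u)).1 = (e (j, v)).1 ∧ (e (i, u)).2 = (e (j, v)).2 ↔ i = j ∧ u = v := by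
      rw [← Prod.ext_iff, e.injective.eq_iff, Prod.mk.injEq]
    simp only [amplifyReindex_apply, Equiv.prodProdCongr, Matrix.one_apply, diagonal_apply,
      Equiv.trans_apply, Equiv.prodAssoc_apply, Equiv.prodCongr_apply, Prod.map, Equiv.refl_apply,
      Equiv.prodAssoc_symm_apply, single_apply, Prod.mk.injEq, mul_ite, mul_one, mul_zero,
      ← ite_and]
    refine if_congr ?_ rfl rfl
    constructor
    · rintro ⟨h1, ⟨h2, h3⟩, h4, h5⟩
      obtain ⟨rfl, rfl⟩ := h.1 ⟨h3.symm.trans h5, h1⟩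
      exact ⟨⟨⟨h2.symm.trans h4, rfl⟩, rfl⟩, h2.symm, h3.symm⟩
    · rintro ⟨⟨⟨rfl, rfl⟩, rfl⟩, h2, h3⟩
      exact ⟨rfl, ⟨h2.symm, h3.symm⟩, h2.symm, h3.symm⟩
  have hp : ∀ i u, (e (i, u)).1 = c → i = p := by
    intro i u h
    rw [← hc (e (i, u)).2, ← h, Prod.mk.eta, e.symm_apply_apply]
  rw [hD]
  ext ⟨⟨t, i⟩, u⟩ ⟨⟨t', j⟩, v⟩
  simp only [diagonal_mul, mul_diagonal, Matrix.smul_apply, diagonal_apply, kroneckerMap_apply,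
    smul_eq_mul, Matrix.one_apply, Prod.mk.injEq]
  by_cases h1 : t = s ∧ (e (i, u)).1 = c
  · by_cases h2 : t' = s ∧ (e (j, v)).1 = c
    · obtain ⟨rfl, h1⟩ := h1
      obtain ⟨rfl, h2⟩ := h2
      obtain rfl := hp _ _ h1
      obtain rfl := hp _ _ h2
      simp [h1, h2]
    · have h3 : ¬ (((t = t' ∧ i = j) ∧ u = v)) := by
        rintro ⟨⟨rfl, rfl⟩, rfl⟩; exact h2 h1
      simp [h2, h3]
  · simp [h1]

/-! ### Averaging over matrix units -/

theorem IsSelfAdjoint.norm_le_of_neg_le_of_le {A : Type*} [CStarAlgebra A] [PartialOrder A]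
    [StarOrderedRing A] [Nontrivial A] {a : A} (ha : IsSelfAdjoint a) {r : ℝ}
    (h₁ : -(algebraMap ℝ A r) ≤ a) (h₂ : a ≤ algebraMap ℝ A r) : ‖a‖ ≤ r := by
  rcases CStarAlgebra.norm_or_neg_norm_mem_spectrum ha with h | h
  · exact (le_algebraMap_iff_spectrum_le ha).1 h₂ _ h
  · rw [← map_neg] at h₁
    have := (algebraMap_le_iff_le_spectrum ha).1 h₁ _ h
    linarith

section Average

variable {A : Type*} [CStarAlgebra A] {γ : Type} [Fintype γ] [DecidableEq γ]

open Matrix in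
/-- The compression of `x` to the `c`-th diagonal matrix unit, spread over the diagonal. -/
def columnAverage (F : Matrix γ γ ℂ →⋆ₐ[ℂ] A) (c : γ) : A →ₗ[ℂ] A where
  toFun x := ∑ j, F (single j c 1) * x * F (single c j 1)
  map_add' x y := by simp only [mul_add, add_mul, Finset.sum_add_distrib]
  map_smul' r x := by
    simp only [mul_smul_comm, smul_mul_assoc, ← Finset.smul_sum, RingHom.id_apply]

open Matrix in
theorem columnAverage_apply (F : Matrix γ γ ℂ →⋆ₐ[ℂ] A) (c : γ) (x : A) :
    columnAverage F c x = ∑ j, F (single j c 1) * x * F (single c j 1) := rfl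

open Matrix in
theorem map_single_mul_map_single (F : Matrix γ γ ℂ →⋆ₐ[ℂ] A) (i j k : γ) :
    F (single i j 1) * F (single j k 1) = F (single i k 1) := by
  rw [← map_mul, single_mul_single_same, one_mul]

open Matrix in
theorem star_map_single (F : Matrix γ γ ℂ →⋆ₐ[ℂ] A) (i j : γ) :
    star (F (single i j 1)) = F (single j i 1) := by
  rw [← map_star, star_eq_conjTranspose, conjTranspose_single, star_one]

open Matrix in
theorem sum_map_single (F : Matrix γ γ ℂ →⋆ₐ[ℂ] A) : ∑ i, F (single i i 1) = 1 := by
  rw [← map_sum, sum_single_one, map_one]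

theorem columnAverage_one (F : Matrix γ γ ℂ →⋆ₐ[ℂ] A) (c : γ) : columnAverage F c 1 = 1 := by
  simp only [columnAverage_apply, mul_one, map_single_mul_map_single, sum_map_single]

theorem columnAverage_algebraMap (F : Matrix γ γ ℂ →⋆ₐ[ℂ] A) (c : γ) (r : ℝ) :
    columnAverage F c (algebraMap ℝ A r) = algebraMap ℝ A r := by
  have : algebraMap ℝ A r = (r : ℂ) • (1 : A) := by
    rw [Algebra.algebraMap_eq_smul_one]; exact (Complex.coe_smul r (1 : A)).symm
  rw [this, map_smul, columnAverage_one]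

theorem star_columnAverage (F : Matrix γ γ ℂ →⋆ₐ[ℂ] A) (c : γ) (x : A) :
    star (columnAverage F c x) = columnAverage F c (star x) := by
  simp only [columnAverage_apply, star_sum, star_mul, star_map_single, mul_assoc]

theorem columnAverage_mono [PartialOrder A] [StarOrderedRing A] (F : Matrix γ γ ℂ →⋆ₐ[ℂ] A)
    (c : γ) {x y : A} (h : x ≤ y) : columnAverage F c x ≤ columnAverage F c y := by
  refine Finset.sum_le_sum fun j _ => ?_
  rw [← star_map_single F c j]
  exact star_left_conjugate_le_conjugate h _

/-- A unital positive map preserves order bounds of the form `-r ≤ x ≤ r`. -/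
theorem norm_columnAverage_le [PartialOrder A] [StarOrderedRing A] [Nontrivial A]
    (F : Matrix γ γ ℂ →⋆ₐ[ℂ] A) (c : γ) {x : A} (hx : IsSelfAdjoint x) :
    ‖columnAverage F c x‖ ≤ ‖x‖ := by
  refine IsSelfAdjoint.norm_le_of_neg_le_of_le ?_ ?_ ?_
  · rw [isSelfAdjoint_iff, star_columnAverage, hx]
  · rw [← columnAverage_algebraMap F c, ← map_neg]
    exact columnAverage_mono F c hx.neg_algebraMap_norm_le_self
  · rw [← columnAverage_algebraMap F c]
    exact columnAverage_mono F c hx.le_algebraMap_norm_self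

open Matrix in
theorem columnAverage_of_compress_eq (F : Matrix γ γ ℂ →⋆ₐ[ℂ] A) {c : γ} {x : A} {y : ℂ}
    (h : F (single c c 1) * x * F (single c c 1) = y • F (single c c 1)) :
    columnAverage F c x = y • 1 := by
  rw [← sum_map_single F, Finset.smul_sum, columnAverage_apply]
  refine Finset.sum_congr rfl fun j _ => ?_
  calc F (single j c 1) * x * F (single c j 1)
      = F (single j c 1) * (F (single c c 1) * x * F (single c c 1)) * F (single c j 1) := by
        have h' : F (single j c 1) * (F (single c c 1) * x * F (single c c 1)) * F (single c j 1)
            = F (single j c 1) * F (single c c 1) * x * (F (single c c 1) * F (single c j 1)) := by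
          simp only [mul_assoc]
        rw [h', map_single_mul_map_single, map_single_mul_map_single]
    _ = y • F (single j j 1) := by
        rw [h, mul_smul_comm, smul_mul_assoc, map_single_mul_map_single,
          map_single_mul_map_single]

/-- The average of `x` over the matrix units: the conditional expectation onto the commutant. -/
noncomputable def matrixAverage (F : Matrix γ γ ℂ →⋆ₐ[ℂ] A) : A →ₗ[ℂ] A :=
  (Fintype.card γ : ℂ)⁻¹ • ∑ c, columnAverage F c

theorem matrixAverage_apply (F : Matrix γ γ ℂ →⋆ₐ[ℂ] A) (x : A) :
    matrixAverage F x = (Fintype.card γ : ℂ)⁻¹ • ∑ c, columnAverage F c x := by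
  simp [matrixAverage]

theorem norm_inv_smul_sum_columnAverage_le [PartialOrder A] [StarOrderedRing A] [Nontrivial A]
    (F : Matrix γ γ ℂ →⋆ₐ[ℂ] A) (s : Finset γ) {x : A} (hx : IsSelfAdjoint x) :
    ‖(Fintype.card γ : ℂ)⁻¹ • ∑ c ∈ s, columnAverage F c x‖
      ≤ s.card / Fintype.card γ * ‖x‖ := by
  rw [norm_smul, norm_inv, Complex.norm_natCast, div_mul_eq_mul_div, div_eq_inv_mul]
  gcongr
  refine (norm_sum_le _ _).trans ((Finset.sum_le_sum fun c _ =>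
    norm_columnAverage_le F c hx).trans_eq ?_)
  rw [Finset.sum_const, nsmul_eq_mul]

theorem norm_matrixAverage_le [PartialOrder A] [StarOrderedRing A] [Nontrivial A]
    (F : Matrix γ γ ℂ →⋆ₐ[ℂ] A) {x : A} (hx : IsSelfAdjoint x) :
    ‖matrixAverage F x‖ ≤ ‖x‖ := by
  rw [matrixAverage_apply]
  refine (norm_inv_smul_sum_columnAverage_le F Finset.univ hx).trans ?_
  rw [Finset.card_univ]
  exact mul_le_of_le_one_left (norm_nonneg _) (div_self_le_one _)

open Matrix in
/-- If `x` is compressed to a scalar by all diagonal matrix units outside `bad`, its average is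
close to a scalar. -/
theorem exists_norm_matrixAverage_sub_le [PartialOrder A] [StarOrderedRing A] [Nontrivial A]
    (F : Matrix γ γ ℂ →⋆ₐ[ℂ] A) (bad : Finset γ) {x : A} (hx : IsSelfAdjoint x) (y : γ → ℂ)
    (h : ∀ c ∉ bad, F (single c c 1) * x * F (single c c 1) = y c • F (single c c 1)) :
    ∃ r : ℂ, ‖matrixAverage F x - r • 1‖ ≤ bad.card / Fintype.card γ * ‖x‖ := by
  -- This is the contribution of the good columns, each averaging to `y c`; the error is the
  -- contribution of the bad ones, each of norm at most `‖x‖`.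
  refine ⟨(Fintype.card γ : ℂ)⁻¹ * ∑ c ∈ badᶜ, y c, ?_⟩
  have : matrixAverage F x - ((Fintype.card γ : ℂ)⁻¹ * ∑ c ∈ badᶜ, y c) • (1 : A)
      = (Fintype.card γ : ℂ)⁻¹ • ∑ c ∈ bad, columnAverage F c x := by
    rw [matrixAverage_apply, ← Finset.sum_add_sum_compl bad, smul_add, mul_smul, Finset.sum_smul,
      Finset.sum_congr rfl fun c hc =>
        columnAverage_of_compress_eq F (h c (Finset.mem_compl.1 hc)), add_sub_cancel_right]
  rw [this]
  exact norm_inv_smul_sum_columnAverage_le F bad hx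

open Matrix in
-- As `b` commutes with the units, `y e_cc b = e_cc x b e_cc = 0`. The units `e_jc` and `e_cj` then
-- spread `e_cc b = 0` to every `e_jj b`.
theorem eq_zero_of_compress_ne_zero (F : Matrix γ γ ℂ →⋆ₐ[ℂ] A) {c : γ} {x b : A} {y : ℂ}
    (hy : y ≠ 0) (h : F (single c c 1) * x * F (single c c 1) = y • F (single c c 1))
    (hb : ∀ X, F X * b = b * F X) (hxb : x * b = 0) : b = 0 := by
  have h0 : F (single c c 1) * b = 0 := by
    have : y • (F (single c c 1) * b) = 0 := by
      rw [← smul_mul_assoc, ← h, mul_assoc, hb, ← mul_assoc, mul_assoc _ x b, hxb]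
      simp
    exact (smul_eq_zero.1 this).resolve_left hy
  rw [← one_mul b, ← sum_map_single F, Finset.sum_mul]
  refine Finset.sum_eq_zero fun j _ => ?_
  rw [← map_single_mul_map_single F j c j, mul_assoc, hb, ← mul_assoc,
    ← map_single_mul_map_single F j c c, mul_assoc (F _), h0]
  simp

/-- Each term has trace `τ(e_cc x)`, whatever `j` is. This identifies the scalar to which averages
converge. -/
theorem tracial_matrixAverage [Nonempty γ] (F : Matrix γ γ ℂ →⋆ₐ[ℂ] A) (τ : A →ₗ[ℂ] ℂ)
    (hτ : ∀ x y, τ (x * y) = τ (y * x)) (x : A) : τ (matrixAverage F x) = τ x := by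
  have h : ∀ c j, τ (F (Matrix.single j c 1) * x * F (Matrix.single c j 1))
      = τ (F (Matrix.single c c 1) * x) := by
    intro c j
    rw [hτ, ← mul_assoc, map_single_mul_map_single]
  rw [matrixAverage_apply, map_smul, map_sum]
  simp only [columnAverage_apply, map_sum, h, Finset.sum_const, Finset.card_univ]
  rw [← Finset.smul_sum, ← map_sum, ← Finset.sum_mul, sum_map_single, one_mul, nsmul_eq_mul,
    smul_eq_mul, inv_mul_cancel_left₀]
  exact_mod_cast Fintype.card_ne_zero

open Matrix in
theorem eq_zero_of_compress_eq_zero [PartialOrder A] [StarOrderedRing A]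
    (F : Matrix γ γ ℂ →⋆ₐ[ℂ] A) {x : A} (hx : 0 ≤ x)
    (h : ∀ c, F (single c c 1) * x * F (single c c 1) = 0) : x = 0 := by
  -- With `x = z*z`, the hypothesis says `(z e_cc)*(z e_cc) = 0`, so `z e_cc = 0` for every `c`.
  obtain ⟨z, rfl⟩ := CStarAlgebra.nonneg_iff_eq_star_mul_self.1 hx
  have hz : z = 0 := by
    rw [← mul_one z, ← sum_map_single F, Finset.mul_sum]
    refine Finset.sum_eq_zero fun c _ => ?_
    rw [← CStarRing.star_mul_self_eq_zero_iff, star_mul, star_map_single, ← h c]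
    simp only [mul_assoc]
  simp [hz]

end Average

/-! ### The extension step -/

theorem Matrix.card_eq_of_starAlgEquiv {m n : Type} [Fintype m] [DecidableEq m] [Fintype n]
    [DecidableEq n] (e : Matrix m m ℂ ≃⋆ₐ[ℂ] Matrix n n ℂ) : Fintype.card m = Fintype.card n := by
  have h := e.toAlgEquiv.toLinearEquiv.finrank_eq
  rw [Module.finrank_matrix, Module.finrank_matrix, Module.finrank_self, mul_one, mul_one] at h
  exact Nat.mul_self_inj.1 h

theorem StarAlgHom.exists_comp_eq_of_range_le {C D A : Type*} [Semiring C] [Algebra ℂ C] [StarRing C]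
    [Semiring D] [Algebra ℂ D] [StarRing D] [Semiring A] [Algebra ℂ A] [StarRing A]
    [StarModule ℂ A] [StarModule ℂ C] [StarModule ℂ D] (f : C →⋆ₐ[ℂ] A) (g : D →⋆ₐ[ℂ] A)
    (hg : Function.Injective g) (h : ∀ x, f x ∈ g.range) : ∃ k : C →⋆ₐ[ℂ] D, ∀ x, g (k x) = f x := by
  let e := StarAlgEquiv.ofInjective g hg
  refine ⟨(e.symm : g.range →⋆ₐ[ℂ] D).comp (f.codRestrict g.range h), fun x => ?_⟩
  exact congrArg Subtype.val (e.apply_symm_apply (f.codRestrict g.range h x))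

open Matrix Kronecker in
/-- One step of the construction: a unital star homomorphism between full matrix algebras of the
two towers extends to the next stage in such a way that almost all compressions by the new
diagonal matrix units are scalar on the old stage. -/
theorem exists_extension_step {A B : Type*} [CStarAlgebra A] [PartialOrder A] [StarOrderedRing A]
    [CStarAlgebra B] {α α' β β' : Type} [Fintype α] [DecidableEq α] [Nonempty α]
    [Fintype α'] [DecidableEq α'] [Fintype β] [DecidableEq β] [Nonempty β]
    [Fintype β'] [DecidableEq β']
    (G : Matrix α α ℂ →⋆ₐ[ℂ] A) (G' : Matrix α' α' ℂ →⋆ₐ[ℂ] A)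
    (H : Matrix β β ℂ →⋆ₐ[ℂ] B) (H' : Matrix β' β' ℂ →⋆ₐ[ℂ] B) (ψ : Matrix β β ℂ →⋆ₐ[ℂ] A)
    (hG : Function.Injective G) (hG' : Function.Injective G') (hH' : Function.Injective H')
    (hψ : ∀ x, ψ x ∈ G.range) (hGG' : G.range ≤ G'.range) (hHH' : H.range ≤ H'.range)
    (hdvd : Fintype.card β' ∣ Fintype.card α') {K : ℕ} (hK : 0 < K)
    (hle : Fintype.card α * K ≤ Fintype.card β') :
    ∃ ψ' : Matrix β' β' ℂ →⋆ₐ[ℂ] A, (∀ x, ψ' x ∈ G'.range) ∧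
      (∀ X X', H' X' = H X → ψ' X' = ψ X) ∧
      ∃ (γ : Type) (_ : Fintype γ) (_ : DecidableEq γ) (_ : Nonempty γ)
        (F : Matrix γ γ ℂ →⋆ₐ[ℂ] A) (bad : Finset γ), F.range = ψ'.range ∧
        bad.card * K ≤ Fintype.card γ ∧
        ∀ x ∈ G.range, ∃ y : γ → ℂ,
          (∀ c ∉ bad, F (single c c 1) * x * F (single c c 1) = y c • F (single c c 1)) ∧
          (x ≠ 0 → 0 ≤ x → ∃ c ∉ bad, y c ≠ 0) := by
  -- Coordinates are chosen with `α = β × δ`, `β' = β × κ` and `α' = (β × δ) × l`, in which `ψ` and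
  -- both inclusions are amplifications.
  obtain ⟨f₀, hf₀⟩ := StarAlgHom.exists_comp_eq_of_range_le ψ G hG hψ
  obtain ⟨δ, _, _, e₁, he₁⟩ := exists_equiv_amplification f₀
  obtain ⟨f₁, hf₁⟩ := StarAlgHom.exists_comp_eq_of_range_le H H' hH' (fun x => hHH' ⟨x, rfl⟩)
  obtain ⟨κ, _, _, e₂, he₂⟩ := exists_equiv_amplification f₁
  obtain ⟨f₂, hf₂⟩ := StarAlgHom.exists_comp_eq_of_range_le
    (G.comp (e₁ : Matrix (β × δ) (β × δ) ℂ →⋆ₐ[ℂ] Matrix α α ℂ)) G' hG'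
    (fun x => hGG' ⟨e₁ x, rfl⟩)
  have c₁ := card_eq_of_starAlgEquiv e₁
  have c₂ := card_eq_of_starAlgEquiv e₂
  have hβ : 0 < Fintype.card β := Fintype.card_pos
  have hα : 0 < Fintype.card α := Fintype.card_pos
  rw [Fintype.card_prod] at c₁ c₂
  have hδ : Nonempty δ := by
    rw [← Fintype.card_pos_iff]
    exact Nat.pos_of_mul_pos_left (c₁.symm ▸ hα)
  obtain ⟨l, _, _, e₃, he₃⟩ := exists_equiv_amplification f₂
  have c₃ := card_eq_of_starAlgEquiv e₃
  rw [Fintype.card_prod, Fintype.card_prod] at c₃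
  obtain ⟨d, hd⟩ := hdvd
  have hcard : Fintype.card δ * Fintype.card l = Fintype.card κ * d := by
    refine Nat.eq_of_mul_eq_mul_left hβ ?_
    rw [← mul_assoc, c₃, hd, ← c₂, mul_assoc]
  obtain ⟨e, bad, p, hbad, hconst, hhit⟩ := exists_prod_equiv_prod_const_fst d hcard
  set ρ := amplifyReindex (Equiv.prodProdCongr (β := β) e) with hρ
  let F : Matrix (β × κ) (β × κ) ℂ →⋆ₐ[ℂ] A :=
    (G'.comp (e₃ : Matrix ((β × δ) × l) ((β × δ) × l) ℂ →⋆ₐ[ℂ] Matrix α' α' ℂ)).comp ρ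
  have hF : ∀ X, F X = G' (e₃ (ρ X)) := fun _ => rfl
  let ψ' : Matrix β' β' ℂ →⋆ₐ[ℂ] A :=
    F.comp (e₂.symm : Matrix β' β' ℂ →⋆ₐ[ℂ] Matrix (β × κ) (β × κ) ℂ)
  have hψ' : ∀ X, ψ' X = F (e₂.symm X) := fun _ => rfl
  have hκ : Fintype.card δ ≤ Fintype.card κ := by
    refine Nat.le_of_mul_le_mul_left ?_ hβ
    rw [c₁, c₂]
    exact (Nat.le_mul_of_pos_right _ hK).trans hle
  have hκ' : Nonempty κ := by
    rw [← Fintype.card_pos_iff]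
    exact Fintype.card_pos.trans_le hκ
  refine ⟨ψ', fun x => ⟨_, rfl⟩, fun X X' h => ?_, β × κ, inferInstance, inferInstance,
    inferInstance, F, Finset.univ ×ˢ bad, ?_, ?_, ?_⟩
  · have h1 : X' = e₂ (X ⊗ₖ 1) := hH' (by rw [h, he₂, hf₁])
    rw [hψ', h1, StarAlgEquiv.symm_apply_apply, hF, hρ, amplifyReindex_kronecker_one, he₃, hf₂]
    change G (e₁ _) = _
    rw [he₁, hf₀]
  · ext x
    constructor
    · rintro ⟨X, rfl⟩
      refine ⟨e₂ X, ?_⟩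
      change ψ' (e₂ X) = F X
      rw [hψ', StarAlgEquiv.symm_apply_apply]
    · rintro ⟨X, rfl⟩
      exact ⟨e₂.symm X, rfl⟩
  -- `|β| |bad| K ≤ |β| |δ| K = |α| K ≤ |β'| = |β × κ|`.
  · rw [Finset.card_product, Finset.card_univ, Fintype.card_prod, c₂]
    refine le_trans ?_ hle
    rw [← c₁]
    gcongr
  · rintro x ⟨Z, rfl⟩
    obtain ⟨Y, rfl⟩ := e₁.surjective Z
    have hx : G (e₁ Y) = G' (e₃ (Y ⊗ₖ 1)) := by
      rw [he₃, hf₂]; rfl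
    refine ⟨fun c => Y (c.1, p c.2) (c.1, p c.2), ?_, ?_⟩
    · rintro ⟨s, c⟩ hc
      have hc' : c ∉ bad := fun h => hc (by simp [h])
      change F _ * G (e₁ Y) * F _ = _
      rw [hx, hF, ← map_mul, ← map_mul, ← map_mul, ← map_mul,
        amplifyReindex_compress e s (hconst c hc') Y, map_smul, map_smul]
    · intro hne hpos
      by_contra! hcon
      refine hne (eq_zero_of_compress_eq_zero
        (G.comp (e₁ : Matrix (β × δ) (β × δ) ℂ →⋆ₐ[ℂ] Matrix α α ℂ)) hpos ?_)
      rintro ⟨s, i⟩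
      -- Every `i` in `δ` is `p c` for a good `c`, so if all `y c` at good indices vanish, the
      -- diagonal of `Y` is zero.
      obtain ⟨c, hc, rfl⟩ := hhit hκ i
      have h0 := hcon (s, c) (by simpa using hc)
      change G (e₁ _) * G (e₁ Y) * G (e₁ _) = 0
      rw [← map_mul, ← map_mul, ← map_mul, ← map_mul, single_mul_mul_single]
      simp only at h0
      simp [h0]

/-! ### Towers of matrix algebras -/

section Tower

variable {A : Type*} [CStarAlgebra A]

theorem IsMatrixTower.nontrivial {M : ℕ → StarSubalgebra ℂ A} (hM : IsMatrixTower M) :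
    Nontrivial A := by
  by_contra h
  rw [not_nontrivial_iff_subsingleton] at h
  refine (hM.strictMono (Nat.zero_lt_one)).ne (SetLike.ext fun x => ?_)
  rw [Subsingleton.elim x 0]
  exact ⟨fun _ => zero_mem _, fun _ => zero_mem _⟩

theorem IsMatrixTower.exists_starAlgHom {M : ℕ → StarSubalgebra ℂ A} (hM : IsMatrixTower M) :
    ∃ (a : ℕ → ℕ) (G : ∀ n, Matrix (Fin (a n)) (Fin (a n)) ℂ →⋆ₐ[ℂ] A),
      (∀ n, 0 < a n) ∧ (∀ n, Function.Injective (G n)) ∧ ∀ n, (G n).range = M n := by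
  have := hM.nontrivial
  choose a e using hM.matrix
  refine ⟨a, fun n => (M n).subtype.comp
    ((e n).some.symm : Matrix (Fin (a n)) (Fin (a n)) ℂ →⋆ₐ[ℂ] M n), fun n => ?_, fun n => ?_,
    fun n => ?_⟩
  · by_contra h
    have h0 : a n = 0 := by omega
    have hs : Subsingleton (Matrix (Fin (a n)) (Fin (a n)) ℂ) := by
      rw [h0]; infer_instance
    have hs' : Subsingleton (M n) := (e n).some.toEquiv.subsingleton
    exact one_ne_zero (α := A) (congrArg Subtype.val (Subsingleton.elim (1 : M n) 0))
  · exact Subtype.val_injective.comp (e n).some.symm.injective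
  · ext x
    constructor
    · rintro ⟨X, rfl⟩
      exact ((e n).some.symm X).2
    · intro hx
      exact ⟨(e n).some ⟨x, hx⟩, congrArg Subtype.val ((e n).some.symm_apply_apply ⟨x, hx⟩)⟩

end Tower

/-! ### Existence of the trace -/

section Trace

variable {A : Type*} [CStarAlgebra A] {γ : Type} [Fintype γ] [DecidableEq γ]

open scoped Matrix.Norms.L2Operator in
theorem Matrix.norm_starAlgHom_apply (G : Matrix γ γ ℂ →⋆ₐ[ℂ] A) (hG : Function.Injective G)
    (X : Matrix γ γ ℂ) : ‖G X‖ = ‖X‖ :=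
  NonUnitalStarAlgHom.norm_map G hG X

open Matrix in
theorem norm_map_single_le (G : Matrix γ γ ℂ →⋆ₐ[ℂ] A) (i : γ) : ‖G (single i i 1)‖ ≤ 1 := by
  have h : ‖G (single i i 1)‖ * ‖G (single i i 1)‖ = ‖G (single i i 1)‖ := by
    rw [← CStarRing.norm_star_mul_self, star_map_single, map_single_mul_map_single]
  by_contra! hlt
  nlinarith

open Matrix in
theorem norm_apply_le_norm_map (G : Matrix γ γ ℂ →⋆ₐ[ℂ] A) (hG : Function.Injective G)
    (X : Matrix γ γ ℂ) (i : γ) : ‖X i i‖ ≤ ‖G X‖ := by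
  have h1 : ‖G (single i i 1)‖ = 1 := by
    have h0 : ‖G (single i i 1)‖ ≠ 0 := by
      rw [norm_ne_zero_iff, map_ne_zero_iff G hG]
      intro h
      simpa using congrFun (congrFun h i) i
    have h : ‖G (single i i 1)‖ * ‖G (single i i 1)‖ = ‖G (single i i 1)‖ := by
      rw [← CStarRing.norm_star_mul_self, star_map_single, map_single_mul_map_single]
    exact mul_right_cancel₀ h0 (by rw [h, one_mul])
  have h2 : G (single i i 1) * G X * G (single i i 1) = X i i • G (single i i 1) := by
    rw [← map_mul, ← map_mul, single_mul_mul_single, ← map_smul]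
    simp
  calc ‖X i i‖ = ‖X i i • G (single i i 1)‖ := by rw [norm_smul, h1, mul_one]
    _ ≤ ‖G (single i i 1)‖ * ‖G X‖ * ‖G (single i i 1)‖ := by
      rw [← h2]
      exact (norm_mul_le _ _).trans (by gcongr; exact norm_mul_le _ _)
    _ = ‖G X‖ := by rw [h1, one_mul, mul_one]

open Matrix in
theorem norm_trace_div_card_le (G : Matrix γ γ ℂ →⋆ₐ[ℂ] A) (hG : Function.Injective G)
    (X : Matrix γ γ ℂ) : ‖X.trace / Fintype.card γ‖ ≤ ‖G X‖ := by
  rw [norm_div, Complex.norm_natCast]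
  refine div_le_of_le_mul₀ (by positivity) (norm_nonneg _) ?_
  refine (norm_sum_le _ _).trans ((Finset.sum_le_sum fun i _ =>
    norm_apply_le_norm_map G hG X i).trans_eq ?_)
  rw [Finset.sum_const, Finset.card_univ, nsmul_eq_mul, mul_comm]

open Matrix in
/-- The normalized trace of a matrix subalgebra extends to a functional of norm at most one. -/
theorem exists_extension_trace [Nonempty γ] (G : Matrix γ γ ℂ →⋆ₐ[ℂ] A)
    (hG : Function.Injective G) :
    ∃ τ : StrongDual ℂ A, ‖τ‖ ≤ 1 ∧ ∀ X, τ (G X) = X.trace / Fintype.card γ := by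
  let g : Matrix γ γ ℂ →ₗ[ℂ] A := G.toAlgHom.toLinearMap
  have hg : Function.Injective g := hG
  let e := LinearEquiv.ofInjective g hg
  let f : LinearMap.range g →ₗ[ℂ] ℂ :=
    ((Fintype.card γ : ℂ)⁻¹ • traceLinearMap γ ℂ ℂ).comp e.symm.toLinearMap
  have hf : ∀ X, f (e X) = X.trace / Fintype.card γ := by
    intro X
    simp [f, div_eq_inv_mul]
  have hbound : ∀ x, ‖f x‖ ≤ 1 * ‖x‖ := by
    intro x
    obtain ⟨X, rfl⟩ := e.surjective x
    rw [hf, one_mul]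
    exact norm_trace_div_card_le G hG X
  obtain ⟨τ, hτ, hnorm⟩ := exists_extension_norm_eq (LinearMap.range g) (f.mkContinuous 1 hbound)
  refine ⟨τ, ?_, fun X => ?_⟩
  · rw [hnorm]
    exact f.mkContinuous_norm_le zero_le_one hbound
  · rw [← hf]
    exact hτ (e X)

open Matrix in
-- The `e_ii` are mutually equivalent and sum to 1, so they share the value `1/k`, with `k` the
-- matrix size. For `i ≠ j`, `e_ij = e_ii e_ij` has the trace of `e_ij e_ii = 0`.
theorem tracial_map_eq_trace [Nonempty γ] (G : Matrix γ γ ℂ →⋆ₐ[ℂ] A) (τ : A →ₗ[ℂ] ℂ)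
    (h1 : τ 1 = 1) (hτ : ∀ x y, τ (x * y) = τ (y * x)) (X : Matrix γ γ ℂ) :
    τ (G X) = X.trace / Fintype.card γ := by
  obtain ⟨o⟩ := ‹Nonempty γ›
  have hdiag : ∀ i, τ (G (single i i 1)) = τ (G (single o o 1)) := by
    intro i
    rw [← map_single_mul_map_single G i o i, hτ, map_single_mul_map_single]
  have ho : Fintype.card γ * τ (G (single o o 1)) = 1 := by
    rw [← sum_map_single G, map_sum, Finset.sum_congr rfl fun i _ => hdiag i] at h1
    simpa using h1
  have hc : (Fintype.card γ : ℂ) ≠ 0 := left_ne_zero_of_mul_eq_one ho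
  induction X using Matrix.induction_on' with
  | h_zero => simp
  | h_add p q hp hq => rw [map_add, map_add, hp, hq, trace_add, add_div]
  | h_std_basis i j c =>
    have hs : (single i j c : Matrix γ γ ℂ) = c • single i j 1 := by simp
    rw [hs, map_smul, map_smul, trace_smul, smul_eq_mul, smul_eq_mul, mul_div_assoc]
    congr 1
    by_cases h : i = j
    · subst h
      rw [hdiag, trace_single_eq_same, eq_div_iff hc, mul_comm, ho]
    · rw [trace_single_eq_of_ne _ _ _ h, zero_div, ← map_single_mul_map_single G i i j, hτ, ← map_mul,
        single_mul_single_of_ne _ _ _ _ (Ne.symm h), map_zero, map_zero]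

/-- A UHF-algebra has a continuous normalized tracial functional. -/
theorem IsMatrixTower.exists_trace {M : ℕ → StarSubalgebra ℂ A} (hM : IsMatrixTower M) :
    ∃ τ : StrongDual ℂ A, τ 1 = 1 ∧ ∀ x y, τ (x * y) = τ (y * x) := by
  obtain ⟨a, G, ha, hG, hr⟩ := hM.exists_starAlgHom
  have hmem : ∀ n x, x ∈ M n ↔ ∃ X, G n X = x := by
    intro n x
    rw [← hr]; rfl
  -- Unital functionals in the unit ball that are tracial on `M n`: decreasing, weak-* compact, and
  -- non-empty by extending matrix traces. A common point is tracial on the dense union.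
  let K : ℕ → Set (WeakDual ℂ A) := fun n =>
    (WeakDual.toStrongDual ⁻¹' Metric.closedBall 0 1) ∩
      ({φ | φ 1 = 1} ∩ ⋂ x ∈ M n, ⋂ y ∈ M n, {φ | φ (x * y) = φ (y * x)})
  have hclosed : ∀ n, IsClosed ({φ : WeakDual ℂ A | φ 1 = 1} ∩
      ⋂ x ∈ M n, ⋂ y ∈ M n, {φ : WeakDual ℂ A | φ (x * y) = φ (y * x)}) := by
    intro n
    refine (isClosed_eq (WeakDual.eval_continuous 1) continuous_const).inter ?_
    exact isClosed_biInter fun x _ => isClosed_biInter fun y _ =>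
      isClosed_eq (WeakDual.eval_continuous _) (WeakDual.eval_continuous _)
  have hcompact : IsCompact (WeakDual.toStrongDual ⁻¹' Metric.closedBall (0 : StrongDual ℂ A) 1) :=
    WeakDual.isCompact_closedBall 0 1
  have hne : (⋂ n, K n).Nonempty := by
    refine IsCompact.nonempty_iInter_of_sequence_nonempty_isCompact_isClosed K ?_ ?_ ?_ ?_
    · rintro n φ ⟨h0, h1, h2⟩
      refine ⟨h0, h1, ?_⟩
      simp only [Set.mem_iInter] at h2 ⊢
      intro x hx y hy
      have hle := hM.strictMono.monotone (Nat.le_succ n)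
      exact h2 x (hle hx) y (hle hy)
    · intro n
      have : Nonempty (Fin (a n)) := ⟨⟨0, ha n⟩⟩
      obtain ⟨τ, hτ, htr⟩ := exists_extension_trace (G n) (hG n)
      have hc : ((Fintype.card (Fin (a n)) : ℕ) : ℂ) ≠ 0 := by
        exact_mod_cast Fintype.card_ne_zero
      refine ⟨StrongDual.toWeakDual τ, ?_, ?_, ?_⟩
      · simpa using hτ
      · change τ 1 = 1
        rw [← map_one (G n), htr, Matrix.trace_one, div_self hc]
      · simp only [Set.mem_iInter]
        intro x hx y hy
        obtain ⟨X, rfl⟩ := (hmem n x).1 hx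
        obtain ⟨Y, rfl⟩ := (hmem n y).1 hy
        change τ _ = τ _
        rw [← map_mul, ← map_mul, htr, htr, Matrix.trace_mul_comm]
    · exact hcompact.inter_right (hclosed 0)
    · exact fun n => hcompact.isClosed.inter (hclosed n)
  obtain ⟨φ, hφ⟩ := hne
  rw [Set.mem_iInter] at hφ
  refine ⟨WeakDual.toStrongDual φ, (hφ 0).2.1, ?_⟩
  have hM' : ∀ n, ∀ x ∈ M n, ∀ y ∈ M n, φ (x * y) = φ (y * x) := by
    intro n
    have := (hφ n).2.2
    simp only [Set.mem_iInter] at this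
    exact this
  have hcl : IsClosed {p : A × A | WeakDual.toStrongDual φ (p.1 * p.2)
      = WeakDual.toStrongDual φ (p.2 * p.1)} := isClosed_eq (by fun_prop) (by fun_prop)
  have hdense : Dense ((⋃ n, (M n : Set A)) ×ˢ (⋃ n, (M n : Set A))) := hM.dense.prod hM.dense
  intro x y
  have hsub : ((⋃ n, (M n : Set A)) ×ˢ (⋃ n, (M n : Set A))) ⊆ {p : A × A |
      WeakDual.toStrongDual φ (p.1 * p.2) = WeakDual.toStrongDual φ (p.2 * p.1)} := by
    rintro ⟨x, y⟩ ⟨hx, hy⟩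
    obtain ⟨m, hx⟩ := Set.mem_iUnion.1 hx
    obtain ⟨n, hy⟩ := Set.mem_iUnion.1 hy
    exact hM' (max m n) x (hM.strictMono.monotone (le_max_left m n) hx) y
      (hM.strictMono.monotone (le_max_right m n) hy)
  exact hcl.closure_subset_iff.2 hsub (hdense (x, y))

end Trace

/-! ### Faithfulness of the trace -/

section Faithful

variable {A : Type*} [CStarAlgebra A]

open Matrix in
theorem tracial_star_mul_self_nonneg {M : ℕ → StarSubalgebra ℂ A} (hM : IsMatrixTower M)
    {τ : StrongDual ℂ A} (h1 : τ 1 = 1) (hτ : ∀ x y, τ (x * y) = τ (y * x)) (x : A) :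
    0 ≤ (τ (star x * x)).re := by
  obtain ⟨a, G, ha, hG, hr⟩ := hM.exists_starAlgHom
  have hcl : IsClosed {x : A | 0 ≤ (τ (star x * x)).re} :=
    isClosed_le continuous_const (Complex.continuous_re.comp (by fun_prop))
  refine hcl.closure_subset_iff.2 ?_ (hM.dense x)
  intro x hx
  obtain ⟨n, hx⟩ := Set.mem_iUnion.1 hx
  rw [SetLike.mem_coe, ← hr n] at hx
  obtain ⟨X, rfl⟩ := hx
  have : Nonempty (Fin (a n)) := ⟨⟨0, ha n⟩⟩
  change 0 ≤ (τ (star (G n X) * G n X)).re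
  rw [← map_star, ← map_mul, star_eq_conjTranspose]
  have := tracial_map_eq_trace (G n) (τ : A →ₗ[ℂ] ℂ) h1 hτ (Xᴴ * X)
  rw [ContinuousLinearMap.coe_coe] at this
  rw [this, Complex.div_natCast_re]
  refine div_nonneg ?_ (Nat.cast_nonneg _)
  rw [trace, Complex.re_sum]
  refine Finset.sum_nonneg fun i _ => ?_
  rw [diag_apply, Matrix.mul_apply, Complex.re_sum]
  refine Finset.sum_nonneg fun j _ => ?_
  rw [conjTranspose_apply, Complex.star_def, ← Complex.normSq_eq_conj_mul_self]
  exact Complex.normSq_nonneg _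

theorem tracial_re_mono [PartialOrder A] [StarOrderedRing A] {M : ℕ → StarSubalgebra ℂ A}
    (hM : IsMatrixTower M) {τ : StrongDual ℂ A} (h1 : τ 1 = 1)
    (hτ : ∀ x y, τ (x * y) = τ (y * x)) {x y : A} (hxy : x ≤ y) : (τ x).re ≤ (τ y).re := by
  obtain ⟨z, hz⟩ := CStarAlgebra.nonneg_iff_eq_star_mul_self.1 (sub_nonneg.2 hxy)
  have := tracial_star_mul_self_nonneg hM h1 hτ z
  rw [← hz, map_sub, Complex.sub_re] at this
  linarith

open Matrix Matrix.Norms.L2Operator in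
/-- The tracial state of a UHF-algebra is faithful. -/
theorem tracial_star_mul_self_ne_zero [PartialOrder A] [StarOrderedRing A]
    {M : ℕ → StarSubalgebra ℂ A} (hM : IsMatrixTower M) {τ : StrongDual ℂ A} (h1 : τ 1 = 1)
    (hτ : ∀ x y, τ (x * y) = τ (y * x)) {y : A} (hy : y ≠ 0) : τ (star y * y) ≠ 0 := by
  obtain ⟨a, G, ha, hG, hr⟩ := hM.exists_starAlgHom
  have := hM.nontrivial
  have hy' : 0 < ‖y‖ := norm_pos_iff.2 hy
  -- Small enough that `‖w‖ > ‖y‖ / 2`; a vector `v` in the unit ball with `‖W v‖ > ‖y‖ / 2` then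
  -- has `‖W v‖² > ε`.
  set ε := ‖y‖ ^ 2 / 4 with hε
  have hε0 : 0 < ε := by positivity
  obtain ⟨w, hwε, hw⟩ : ∃ w, ‖star y * y - star w * w‖ < ε ∧ w ∈ ⋃ n, (M n : Set A) := by
    have hopen : IsOpen {w : A | ‖star y * y - star w * w‖ < ε} :=
      isOpen_lt (by fun_prop) continuous_const
    have hymem : y ∈ {w : A | ‖star y * y - star w * w‖ < ε} := by
      rw [Set.mem_ofPred_eq, sub_self, norm_zero]; exact hε0
    exact hM.dense.inter_open_nonempty _ hopen ⟨y, hymem⟩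
  obtain ⟨n, hw⟩ := Set.mem_iUnion.1 hw
  rw [SetLike.mem_coe, ← hr n] at hw
  obtain ⟨W, hW⟩ := hw
  replace hW : G n W = w := hW
  let o : Fin (a n) := ⟨0, ha n⟩
  have hne : Nonempty (Fin (a n)) := ⟨o⟩
  have htr : ∀ X, τ (G n X) = X.trace / Fintype.card (Fin (a n)) :=
    tracial_map_eq_trace (G n) (τ : A →ₗ[ℂ] ℂ) h1 hτ
  have hWn : ‖y‖ / 2 < ‖W‖ := by
    rw [← norm_starAlgHom_apply (G n) (hG n), hW]
    have h2 : ‖star y * y‖ ≤ ‖star y * y - star w * w‖ + ‖star w * w‖ := by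
      simpa using norm_add_le (star y * y - star w * w) (star w * w)
    rw [CStarRing.norm_star_mul_self, CStarRing.norm_star_mul_self] at h2
    by_contra! hle
    nlinarith [norm_nonneg w]
  rw [cstar_norm_def] at hWn
  obtain ⟨v, hv, hWv⟩ := ContinuousLinearMap.exists_lt_apply_of_lt_opNorm _ hWn
  set u : Fin (a n) → ℂ := W *ᵥ v.ofLp with hu
  have hvec : ∀ z : EuclideanSpace ℂ (Fin (a n)), (star z.ofLp ⬝ᵥ z.ofLp) = (‖z‖ ^ 2 : ℝ) := by
    intro z
    rw [EuclideanSpace.norm_sq_eq, Complex.ofReal_sum, dotProduct]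
    refine Finset.sum_congr rfl fun i _ => ?_
    rw [Pi.star_apply, Complex.star_def, ← Complex.normSq_eq_conj_mul_self, Complex.sq_norm]
  -- The rank-one matrix `v e_o*` turns vector norms into traces: `T*T = ‖v‖² e_oo` and `(WT)*(WT) =
  -- ‖W v‖² e_oo`.
  set T : Matrix (Fin (a n)) (Fin (a n)) ℂ := vecMulVec v.ofLp (Pi.single o 1) with hT
  set t : A := G n T with ht
  have hcol : ∀ z : Fin (a n) → ℂ, (vecMulVec z (Pi.single o 1))ᴴ * vecMulVec z (Pi.single o 1)
      = (star z ⬝ᵥ z) • single o o (1 : ℂ) := by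
    intro z
    ext i j
    simp only [Matrix.mul_apply, conjTranspose_apply, vecMulVec_apply, Matrix.smul_apply,
      single_apply, Pi.single_apply, dotProduct, smul_eq_mul, Finset.sum_mul, Pi.star_apply]
    refine Finset.sum_congr rfl fun k _ => ?_
    by_cases hi : i = o <;> by_cases hj : j = o <;> simp [hi, hj, eq_comm]
  have htt : star t * t = ((‖v‖ ^ 2 : ℝ) : ℂ) • G n (single o o 1) := by
    rw [ht, ← map_star, ← map_mul, star_eq_conjTranspose, hT, hcol, hvec, map_smul]
  have hwt : star (w * t) * (w * t)
      = ((‖toEuclideanCLM (n := Fin (a n)) (𝕜 := ℂ) W v‖ ^ 2 : ℝ) : ℂ) • G n (single o o 1) := by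
    rw [ht, ← hW, ← map_mul, ← map_star, ← map_mul, star_eq_conjTranspose, hT, mul_vecMulVec, hcol,
      ← hvec, map_smul]
    rfl
  have htn : ‖t‖ ≤ 1 := by
    have h2 : ‖t‖ * ‖t‖ ≤ 1 := by
      rw [← CStarRing.norm_star_mul_self, htt, norm_smul, Complex.norm_real, Real.norm_eq_abs,
        abs_of_nonneg (by positivity)]
      have := norm_map_single_le (G n) o
      nlinarith [norm_nonneg v, norm_nonneg (G n (single o o 1))]
    nlinarith [norm_nonneg t]
  have hsingle : τ (G n (single o o 1)) = 1 / Fintype.card (Fin (a n)) := by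
    rw [htr, trace_single_eq_same]
  set k : ℝ := (Fintype.card (Fin (a n)) : ℝ) with hk
  have hk0 : 0 < k := by rw [hk]; exact_mod_cast Fintype.card_pos
  have hre : ∀ r : ℝ, (τ ((r : ℂ) • G n (single o o 1))).re = r / k := by
    intro r
    rw [map_smul, hsingle, smul_eq_mul, mul_one_div, Complex.div_natCast_re, Complex.ofReal_re]
  -- By the trace property, `τ(t* y*y t) = τ(y t t* y*) ≤ τ(y y*) = τ(y*y)`, as `t t* ≤ 1`.
  have hstep1 : (τ (star t * (star y * y) * t)).re ≤ (τ (star y * y)).re := by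
    have h2 : y * (t * star t) * star y ≤ y * star y := by
      have h3 : t * star t ≤ 1 := by
        refine CStarAlgebra.mul_star_le_algebraMap_norm_sq.trans ?_
        rw [← map_one (algebraMap ℝ A)]
        exact algebraMap_mono A (by nlinarith [norm_nonneg t])
      simpa using star_right_conjugate_le_conjugate h3 y
    have h4 := tracial_re_mono hM h1 hτ h2
    rw [hτ y (star y)] at h4
    refine le_trans (le_of_eq ?_) h4
    rw [show star t * (star y * y) * t = (star t * star y) * (y * t) by simp only [mul_assoc], hτ]
    simp only [mul_assoc]
  have hstep2 : (‖toEuclideanCLM (n := Fin (a n)) (𝕜 := ℂ) W v‖ ^ 2 - ε * ‖v‖ ^ 2) / k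
      ≤ (τ (star t * (star y * y) * t)).re := by
    have hsa : IsSelfAdjoint (star y * y - star w * w) :=
      (IsSelfAdjoint.star_mul_self y).sub (IsSelfAdjoint.star_mul_self w)
    have h2 : -(algebraMap ℝ A ε) ≤ star y * y - star w * w :=
      (neg_le_neg (algebraMap_mono A hwε.le)).trans hsa.neg_algebraMap_norm_le_self
    have h3 : star w * w - (ε : ℂ) • 1 ≤ star y * y := by
      rw [Algebra.algebraMap_eq_smul_one, ← Complex.coe_smul] at h2
      rw [sub_eq_add_neg, add_comm]
      exact le_sub_iff_add_le.1 h2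
    have h4 := tracial_re_mono hM h1 hτ (star_left_conjugate_le_conjugate h3 t)
    refine le_trans (le_of_eq ?_) h4
    have h5 : star t * (star w * w - (ε : ℂ) • 1) * t
        = ((‖toEuclideanCLM (n := Fin (a n)) (𝕜 := ℂ) W v‖ ^ 2 - ε * ‖v‖ ^ 2 : ℝ) : ℂ) •
          G n (single o o 1) := by
      rw [Complex.ofReal_sub, sub_smul, ← hwt, Complex.ofReal_mul, mul_smul, ← htt, star_mul]
      simp only [mul_sub, sub_mul, mul_smul_comm, smul_mul_assoc, mul_one, mul_assoc]
    rw [h5, hre]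
  have hpos : 0 < (‖toEuclideanCLM (n := Fin (a n)) (𝕜 := ℂ) W v‖ ^ 2 - ε * ‖v‖ ^ 2) / k := by
    refine div_pos ?_ hk0
    have h2 : ε < ‖toEuclideanCLM (n := Fin (a n)) (𝕜 := ℂ) W v‖ ^ 2 := by
      rw [hε]; nlinarith
    have h3 : ‖v‖ ^ 2 ≤ 1 := by nlinarith [norm_nonneg v]
    nlinarith
  intro h0
  rw [h0, Complex.zero_re] at hstep1
  linarith

end Faithful

/-! ### Divisibility of matrix sizes -/

section Divisibility

variable {A : Type*} [CStarAlgebra A]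

/-- Nearby projections are similar: `u = pq + (1-p)(1-q)` satisfies `pu = uq`, and it is invertible
because `1 - u = (1-2p)(q-p)` with `1-2p` unitary. -/
theorem tracial_eq_of_norm_projection_sub_lt_one (τ : A →ₗ[ℂ] ℂ)
    (hτ : ∀ x y, τ (x * y) = τ (y * x)) {p q : A} (hp : IsSelfAdjoint p) (hpp : p * p = p)
    (hqq : q * q = q) (h : ‖p - q‖ < 1) : τ p = τ q := by
  rcases subsingleton_or_nontrivial A with _ | _
  · rw [Subsingleton.elim p q]
  set u : A := p * q + (1 - p) * (1 - q) with hu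
  have hs : star (1 - 2 * p) * (1 - 2 * p) = 1 := by
    have h2 : star (1 - 2 * p) = 1 - 2 * p := by
      rw [star_sub, star_one, star_mul, hp.star_eq, star_ofNat, two_mul, mul_two]
    have h3 : (1 - 2 * p) * (1 - 2 * p) = 1 - 4 * p + 4 * (p * p) := by noncomm_ring
    rw [h2, h3, hpp, sub_add_cancel]
  have hsn : ‖1 - 2 * p‖ = 1 := by
    have h2 := CStarRing.norm_star_mul_self (x := 1 - 2 * p)
    rw [hs, CStarRing.norm_one] at h2
    nlinarith [norm_nonneg (1 - 2 * p)]
  have hu1 : 1 - u = (1 - 2 * p) * (q - p) := by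
    have h3 : (1 - 2 * p) * (q - p) = q - p - 2 * (p * q) + 2 * (p * p) := by noncomm_ring
    have h4 : 1 - u = q + p - 2 * (p * q) := by rw [hu]; noncomm_ring
    rw [h3, h4, hpp]; noncomm_ring
  have hun : ‖1 - u‖ < 1 := by
    rw [hu1]
    refine (norm_mul_le _ _).trans_lt ?_
    rwa [hsn, one_mul, norm_sub_rev]
  have hunit : IsUnit u := by
    have := (Units.oneSub (1 - u) hun).isUnit
    rwa [Units.val_oneSub, sub_sub_cancel] at this
  obtain ⟨v, hv⟩ := hunit
  have hpu : p * u = u * q := by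
    have h3 : p * u = p * p * q + (p - p * p) * (1 - q) := by rw [hu]; noncomm_ring
    have h4 : u * q = p * (q * q) + (1 - p) * (q - q * q) := by rw [hu]; noncomm_ring
    rw [h3, h4, hpp, hqq]; simp
  have hpv : p = v * (q * (v⁻¹ : Aˣ)) := by
    rw [← mul_assoc, hv, ← hpu, ← hv, mul_assoc, Units.mul_inv, mul_one]
  rw [hpv, hτ, mul_assoc, Units.inv_mul, mul_one]

open Matrix Matrix.Norms.L2Operator in
/-- An approximately idempotent self-adjoint matrix is close to a projection. -/
theorem Matrix.exists_projection_norm_sub_le {n : Type} [Fintype n] [DecidableEq n]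
    {Z : Matrix n n ℂ} (hZ : IsSelfAdjoint Z) {η : ℝ} (h : ‖Z * Z - Z‖ ≤ η) :
    ∃ Q : Matrix n n ℂ, Q.IsHermitian ∧ Q * Q = Q ∧ ‖Q - Z‖ ≤ 2 * η := by
  have hη : 0 ≤ η := (norm_nonneg _).trans h
  have hfin : (spectrum ℝ Z).Finite := Matrix.finite_real_spectrum
  have hcont : ∀ f : ℝ → ℝ, ContinuousOn f (spectrum ℝ Z) := fun f => hfin.continuousOn f
  -- Rounding moves a spectral point `x` by at most `2 |x² - x|`, since the endpoint of `{0, 1}` not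
  -- chosen is at distance at least `1/2`.
  set f : ℝ → ℝ := fun x => if 1 / 2 < x then 1 else 0 with hf
  refine ⟨cfc f Z, cfc_predicate f Z, ?_, ?_⟩
  · rw [← cfc_mul f f Z (hcont _) (hcont _)]
    congr 1
    ext x
    simp [hf]
  · have h1 : cfc f Z - Z = cfc (fun x => f x - x) Z := by
      rw [cfc_sub f (fun x => x) Z (hcont _) (hcont _), cfc_id' ℝ Z]
    rw [h1]
    refine norm_cfc_le (by positivity) fun x hx => ?_
    have h2 : cfc (fun x : ℝ => x * x - x) Z = Z * Z - Z := by
      rw [cfc_sub (fun x => x * x) (fun x => x) Z (hcont _) (hcont _),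
        cfc_mul (fun x => x) (fun x => x) Z (hcont _) (hcont _), cfc_id' ℝ Z]
    have h3 := norm_apply_le_norm_cfc (fun x : ℝ => x * x - x) Z hx (hcont _)
    rw [h2, Real.norm_eq_abs] at h3
    replace h3 := abs_le.1 (h3.trans h)
    rw [Real.norm_eq_abs, abs_le]
    simp only [hf]
    split_ifs with hlt
    · constructor <;> by_cases h4 : x ≤ 1 <;> nlinarith
    · push Not at hlt
      constructor <;> by_cases h4 : 0 ≤ x <;> nlinarith

open Matrix Matrix.Norms.L2Operator in
/-- If a full matrix algebra embeds unitally into a UHF-algebra, its size divides the sizes of the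
matrix algebras in any tower from some point on. -/
theorem IsMatrixTower.exists_card_dvd {M : ℕ → StarSubalgebra ℂ A} (hM : IsMatrixTower M)
    {a : ℕ → ℕ} (G : ∀ n, Matrix (Fin (a n)) (Fin (a n)) ℂ →⋆ₐ[ℂ] A) (ha : ∀ n, 0 < a n)
    (hG : ∀ n, Function.Injective (G n)) (hr : ∀ n, (G n).range = M n)
    {β : Type} [Fintype β] [DecidableEq β] [Nonempty β] (F : Matrix β β ℂ →⋆ₐ[ℂ] A) :
    ∃ m₀, ∀ m ≥ m₀, Fintype.card β ∣ a m := by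
  obtain ⟨τ, h1, hτ⟩ := hM.exists_trace
  obtain ⟨o⟩ := id ‹Nonempty β›
  set p : A := F (single o o 1) with hp
  have hpsa : IsSelfAdjoint p := star_map_single F o o
  have hpp : p * p = p := map_single_mul_map_single F o o o
  have hpn : ‖p‖ ≤ 1 := norm_map_single_le F o
  -- With error `1/16`, the self-adjoint part `Z` satisfies `‖Z² - Z‖ ≤ 3/16 + 1/256 < 1/4`, so the
  -- projection `Q` is within `1/2 + 1/16 < 1` of `p`.
  obtain ⟨w, hw, hwp⟩ := hM.dense.exists_dist_lt p (show (0 : ℝ) < 1 / 16 by norm_num)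
  obtain ⟨m₀, hw⟩ := Set.mem_iUnion.1 hw
  refine ⟨m₀, fun m hm => ?_⟩
  have hwm : w ∈ (G m).range := by
    rw [hr]; exact hM.strictMono.monotone hm hw
  obtain ⟨W, hW⟩ := hwm
  replace hW : G m W = w := hW
  set Z : Matrix (Fin (a m)) (Fin (a m)) ℂ := (1 / 2 : ℂ) • (W + star W) with hZ
  have hZsa : IsSelfAdjoint Z := by
    rw [isSelfAdjoint_iff, hZ, star_smul, star_add, star_star, add_comm]
    simp
  set h : A := G m Z - p with hh
  have hhn : ‖h‖ ≤ 1 / 16 := by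
    have h2 : h = (1 / 2 : ℂ) • ((w - p) + star (w - p)) := by
      rw [hh, hZ, map_smul, map_add, map_star, hW, star_sub, hpsa.star_eq]
      module
    have h3 : ‖w - p‖ ≤ 1 / 16 := by rw [← dist_eq_norm, dist_comm]; exact hwp.le
    rw [h2, norm_smul]
    have h4 := norm_add_le (w - p) (star (w - p))
    rw [norm_star] at h4
    have h5 : ‖(1 / 2 : ℂ)‖ = 1 / 2 := by norm_num
    rw [h5]
    linarith
  have hZn : ‖Z * Z - Z‖ ≤ 1 / 4 := by
    rw [← norm_starAlgHom_apply (G m) (hG m), map_sub, map_mul]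
    have h2 : G m Z * G m Z - G m Z = p * h + h * p + h * h - h := by
      have h3 : G m Z = p + h := by rw [hh]; abel
      rw [h3, mul_add, add_mul, add_mul, hpp]; abel
    rw [h2]
    have e1 := norm_sub_le (p * h + h * p + h * h) h
    have e2 := norm_add_le (p * h + h * p) (h * h)
    have e3 := norm_add_le (p * h) (h * p)
    have e4 := norm_mul_le p h
    have e5 := norm_mul_le h p
    have e6 := norm_mul_le h h
    nlinarith [norm_nonneg h, norm_nonneg p]
  obtain ⟨Q, hQ, hQQ, hQZ⟩ := exists_projection_norm_sub_le hZsa hZn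
  have hpq : ‖p - G m Q‖ < 1 := by
    have h2 : p - G m Q = -(G m (Q - Z)) - h := by rw [map_sub, hh]; abel
    rw [h2]
    refine (norm_sub_le _ _).trans_lt ?_
    rw [norm_neg, norm_starAlgHom_apply (G m) (hG m)]
    linarith
  have : Nonempty (Fin (a m)) := ⟨⟨0, ha m⟩⟩
  have heq := tracial_eq_of_norm_projection_sub_lt_one (τ : A →ₗ[ℂ] ℂ) hτ hpsa hpp
    (q := G m Q) (by rw [← map_mul, hQQ]) hpq
  rw [hp, tracial_map_eq_trace F _ h1 hτ, tracial_map_eq_trace (G m) _ h1 hτ,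
    trace_single_eq_same, Fintype.card_fin] at heq
  -- `1 / |β| = tr Q / a m`, and `tr Q` is the rank of `Q`, an integer.
  obtain ⟨l, _, _, V, hV, hV'⟩ := exists_isometry_of_projection hQ hQQ
  rw [← hV, trace_mul_comm, hV', trace_one, div_eq_div_iff, one_mul] at heq
  · exact ⟨Fintype.card l, by rw [mul_comm]; exact_mod_cast heq⟩
  · exact_mod_cast Fintype.card_ne_zero
  · exact_mod_cast (ha m).ne'

end Divisibility

/-! ### Extension to the limit algebra -/

section Extension

variable {A B : Type*} [CStarAlgebra A] [CStarAlgebra B]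

theorem StarAlgHom.injective_of_matrix [Nontrivial A] {γ : Type} [Fintype γ] [DecidableEq γ]
    [Nonempty γ] (F : Matrix γ γ ℂ →⋆ₐ[ℂ] A) : Function.Injective F :=
  RingHom.injective (F : Matrix γ γ ℂ →+* A)

theorem exists_of_le_of_compatible {b : ℕ → ℕ}
    (H : ∀ t, Matrix (Fin (b t)) (Fin (b t)) ℂ →⋆ₐ[ℂ] B)
    (ψ : ∀ t, Matrix (Fin (b t)) (Fin (b t)) ℂ →⋆ₐ[ℂ] A)
    (hmono : ∀ t, (H t).range ≤ (H (t + 1)).range)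
    (hcomp : ∀ t X X', H (t + 1) X' = H t X → ψ (t + 1) X' = ψ t X) {s t : ℕ} (hst : s ≤ t)
    (X : Matrix (Fin (b s)) (Fin (b s)) ℂ) : ∃ X', H t X' = H s X ∧ ψ t X' = ψ s X := by
  induction t, hst using Nat.le_induction with
  | base => exact ⟨X, rfl, rfl⟩
  | succ t _ ih =>
    obtain ⟨X', h1, h2⟩ := ih
    obtain ⟨X'', h3⟩ := hmono t ⟨X', rfl⟩
    exact ⟨X'', (show H (t + 1) X'' = H t X' from h3).trans h1, (hcomp t X' X'' h3).trans h2⟩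

open Matrix.Norms.L2Operator in
/-- Compatible unital star homomorphisms on a tower of matrix algebras with dense union extend to
the ambient C*-algebra. -/
theorem exists_starAlgHom_extending [Nontrivial A] [Nontrivial B] {b : ℕ → ℕ} (hb : ∀ t, 0 < b t)
    (H : ∀ t, Matrix (Fin (b t)) (Fin (b t)) ℂ →⋆ₐ[ℂ] B)
    (ψ : ∀ t, Matrix (Fin (b t)) (Fin (b t)) ℂ →⋆ₐ[ℂ] A)
    (hmono : ∀ t, (H t).range ≤ (H (t + 1)).range)
    (hdense : Dense (⋃ t, ((H t).range : Set B)))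
    (hcomp : ∀ t X X', H (t + 1) X' = H t X → ψ (t + 1) X' = ψ t X) :
    ∃ ι : B →⋆ₐ[ℂ] A, Function.Injective ι ∧ ∀ t X, ι (H t X) = ψ t X := by
  have lift : ∀ {s t : ℕ} (_ : s ≤ t) (X : Matrix (Fin (b s)) (Fin (b s)) ℂ),
      ∃ X', H t X' = H s X ∧ ψ t X' = ψ s X :=
    fun hst X => exists_of_le_of_compatible H ψ hmono hcomp hst X
  -- `D` is the graph of the map on the union of the stages, and its closure is the graph of `ι`.
  -- Injective star homomorphisms are isometric, so paired elements have equal norms and the first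
  -- projection is an isometry of the closure onto `B`.
  let D : StarSubalgebra ℂ (B × A) :=
    { carrier := {p | ∃ t X, p = (H t X, ψ t X)}
      mul_mem' := by
        rintro _ _ ⟨s, X, rfl⟩ ⟨t, Y, rfl⟩
        obtain ⟨X', h1, h2⟩ := lift (le_max_left s t) X
        obtain ⟨Y', h3, h4⟩ := lift (le_max_right s t) Y
        exact ⟨max s t, X' * Y', by rw [map_mul, map_mul, h1, h2, h3, h4]; rfl⟩
      add_mem' := by
        rintro _ _ ⟨s, X, rfl⟩ ⟨t, Y, rfl⟩
        obtain ⟨X', h1, h2⟩ := lift (le_max_left s t) X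
        obtain ⟨Y', h3, h4⟩ := lift (le_max_right s t) Y
        exact ⟨max s t, X' + Y', by rw [map_add, map_add, h1, h2, h3, h4]; rfl⟩
      algebraMap_mem' := fun r => ⟨0, algebraMap ℂ _ r, by
        rw [AlgHomClass.commutes, AlgHomClass.commutes]; rfl⟩
      star_mem' := by
        rintro _ ⟨s, X, rfl⟩
        exact ⟨s, star X, by rw [map_star, map_star]; rfl⟩ }
  have hmemD : ∀ t X, (H t X, ψ t X) ∈ D := fun t X => ⟨t, X, rfl⟩
  let K : StarSubalgebra ℂ (B × A) := D.topologicalClosure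
  have hKclosed : IsClosed (K : Set (B × A)) := D.isClosed_topologicalClosure
  have hnorm : ∀ p ∈ K, ‖p.1‖ = ‖p.2‖ := by
    have hcl : IsClosed {p : B × A | ‖p.1‖ = ‖p.2‖} := isClosed_eq (by fun_prop) (by fun_prop)
    intro p hp
    have hsub : (D : Set (B × A)) ⊆ {p : B × A | ‖p.1‖ = ‖p.2‖} := by
      rintro _ ⟨t, X, rfl⟩
      have : Nonempty (Fin (b t)) := ⟨⟨0, hb t⟩⟩
      change ‖H t X‖ = ‖ψ t X‖
      rw [Matrix.norm_starAlgHom_apply _ (StarAlgHom.injective_of_matrix (H t)),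
        Matrix.norm_starAlgHom_apply _ (StarAlgHom.injective_of_matrix (ψ t))]
    exact hcl.closure_subset_iff.2 hsub hp
  let f : K →⋆ₐ[ℂ] B := (StarAlgHom.fst ℂ B A).comp K.subtype
  have hf : ∀ p : K, f p = p.1.1 := fun _ => rfl
  have hfiso : Isometry f := by
    refine AddMonoidHomClass.isometry_of_norm f fun p => ?_
    change ‖p.1.1‖ = ‖p.1‖
    rw [Prod.norm_def, ← hnorm _ p.2, max_self]
  have hcomplete : CompleteSpace K := hKclosed.completeSpace_coe
  have hrange : Set.range f = Set.univ := by
    refine Set.eq_univ_of_univ_subset ?_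
    rw [← hdense.closure_eq]
    refine hfiso.isClosedEmbedding.isClosed_range.closure_subset_iff.2 ?_
    refine Set.iUnion_subset fun t => ?_
    rintro _ ⟨X, rfl⟩
    exact ⟨⟨_, D.le_topologicalClosure (hmemD t X)⟩, rfl⟩
  let e : K ≃⋆ₐ[ℂ] B := StarAlgEquiv.ofBijective f
    ⟨hfiso.injective, Set.range_eq_univ.1 hrange⟩
  have he : ∀ p, e p = p.1.1 := fun _ => rfl
  let ι : B →⋆ₐ[ℂ] A :=
    ((StarAlgHom.snd ℂ B A).comp K.subtype).comp (e.symm : B →⋆ₐ[ℂ] K)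
  have hι : ∀ x, ι x = (e.symm x).1.2 := fun _ => rfl
  refine ⟨ι, ?_, fun t X => ?_⟩
  · rw [injective_iff_map_eq_zero]
    intro x hx
    rw [hι] at hx
    have h1 := hnorm _ (e.symm x).2
    rw [hx, norm_zero, norm_eq_zero, ← he, StarAlgEquiv.apply_symm_apply] at h1
    exact h1
  · have h1 : H t X = e ⟨_, D.le_topologicalClosure (hmemD t X)⟩ := rfl
    rw [hι, h1, StarAlgEquiv.symm_apply_apply]

end Extension

/-! ### Simplicity of intermediate algebras -/

section Irreducible

variable {A B : Type*} [CStarAlgebra A] [CStarAlgebra B]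

theorem IsMatrixTower.comp_strictMono {M : ℕ → StarSubalgebra ℂ A} (hM : IsMatrixTower M)
    {m : ℕ → ℕ} (hm : StrictMono m) : IsMatrixTower (M ∘ m) where
  strictMono := hM.strictMono.comp hm
  matrix n := hM.matrix (m n)
  dense := by
    refine hM.dense.mono (Set.iUnion_subset fun n => ?_)
    exact Set.Subset.trans (hM.strictMono.monotone (hm.id_le n))
      (Set.subset_iUnion (fun k => ((M ∘ m) k : Set A)) n)

theorem IsMatrixTower.strictMono_card {M : ℕ → StarSubalgebra ℂ A} (hM : IsMatrixTower M)
    {a : ℕ → ℕ} (G : ∀ n, Matrix (Fin (a n)) (Fin (a n)) ℂ →⋆ₐ[ℂ] A)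
    (hG : ∀ n, Function.Injective (G n)) (hr : ∀ n, (G n).range = M n) : StrictMono a := by
  let R : ℕ → Submodule ℂ A := fun n => LinearMap.range ((G n).toAlgHom.toLinearMap)
  have hmem : ∀ n x, x ∈ R n ↔ x ∈ M n := by
    intro n x
    rw [← hr]; rfl
  have hfin : ∀ n, Module.finrank ℂ (R n) = a n * a n := by
    intro n
    rw [LinearMap.finrank_range_of_inj (f := (G n).toAlgHom.toLinearMap) (hG n),
      Module.finrank_matrix]
    simp
  refine strictMono_nat_of_lt_succ fun n => ?_
  have hlt := hM.strictMono (Nat.lt_succ_self n)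
  have hRlt : R n < R (n + 1) := by
    refine lt_of_le_not_ge (fun x hx => (hmem _ x).2 (hlt.le ((hmem _ x).1 hx))) fun h => ?_
    exact hlt.not_ge fun x hx => (hmem _ x).1 (h ((hmem _ x).2 hx))
  have := Submodule.finrank_lt_finrank_of_lt hRlt
  rw [hfin, hfin] at this
  exact Nat.mul_self_lt_mul_self_iff.1 this

/-- A closed ideal of an intermediate algebra is stable under averaging over matrix units of the
intermediate algebra. -/
theorem TwoSidedIdeal.exists_coe_eq_matrixAverage {γ : Type} [Fintype γ] [DecidableEq γ]
    (F : Matrix γ γ ℂ →⋆ₐ[ℂ] A) (D : StarSubalgebra ℂ A) (hF : ∀ X, F X ∈ D)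
    (I : TwoSidedIdeal D) {z : D} (hz : z ∈ I) : ∃ w ∈ I, (w : A) = matrixAverage F z := by
  refine ⟨algebraMap ℂ D (Fintype.card γ : ℂ)⁻¹ * ∑ c, ∑ j,
    (⟨F (Matrix.single j c 1), hF _⟩ * z * ⟨F (Matrix.single c j 1), hF _⟩ : D), ?_, ?_⟩
  · exact I.mul_mem_left _ _ (sum_mem fun c _ => sum_mem fun j _ =>
      I.mul_mem_right _ _ (I.mul_mem_left _ _ hz))
  · rw [matrixAverage_apply, ← Algebra.smul_def]
    simp [columnAverage_apply]

/-- For a non-zero `y` in a closed ideal, the averages of `y*y` stay in the ideal and approximate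
the invertible scalar `τ(y*y)`. -/
theorem isSimpleCStar_of_norm_matrixAverage_sub_lt [Nontrivial A]
    (τ : A → ℂ) (hτ : ∀ y, y ≠ 0 → τ (star y * y) ≠ 0) (S : StarSubalgebra ℂ A)
    (hS : ∀ y : A, ∀ ε > 0, ∃ (γ : Type) (_ : Fintype γ) (_ : DecidableEq γ)
      (F : Matrix γ γ ℂ →⋆ₐ[ℂ] A), F.range ≤ S ∧
        ‖matrixAverage F (star y * y) - τ (star y * y) • 1‖ < ε)
    (D : StarSubalgebra ℂ A) (hSD : S ≤ D) : IsSimpleCStar D := by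
  refine ⟨⟨0, 1, fun h => zero_ne_one (congrArg (Subtype.val : D → A) h)⟩, fun I hI => ?_⟩
  by_cases hbot : ∃ y ∈ I, y ≠ 0
  · right
    obtain ⟨y, hy, hy0⟩ := hbot
    have hyA : (y : A) ≠ 0 := fun h => hy0 (Subtype.ext h)
    have hs := hτ y hyA
    set s := τ (star (y : A) * y) with hsdef
    have hmem : algebraMap ℂ D s ∈ I := by
      rw [← SetLike.mem_coe, ← hI.closure_eq, Metric.mem_closure_iff]
      intro ε hε
      obtain ⟨γ, _, _, F, hF, hlt⟩ := hS y ε hε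
      obtain ⟨w, hw, hwF⟩ := I.exists_coe_eq_matrixAverage F D (fun X => hSD (hF ⟨X, rfl⟩))
        (I.mul_mem_left (star y) y hy)
      refine ⟨w, hw, ?_⟩
      rw [dist_comm, Subtype.dist_eq, dist_eq_norm, hwF, Algebra.algebraMap_eq_smul_one]
      exact hlt
    rw [← TwoSidedIdeal.one_mem_iff]
    have := I.mul_mem_left (algebraMap ℂ D s⁻¹) _ hmem
    rwa [← map_mul, inv_mul_cancel₀ hs, map_one] at this
  · left
    push Not at hbot
    refine TwoSidedIdeal.ext fun x => ⟨fun hx => ?_, fun hx => ?_⟩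
    · rw [hbot x hx]; exact zero_mem _
    · rw [(TwoSidedIdeal.mem_bot D).1 hx]; exact zero_mem _

/-- The averages of positive elements tend to the value of the trace, if the averages of the
elements of a dense sequence of subalgebras are asymptotically scalar. -/
theorem exists_norm_matrixAverage_sub_trace_lt [PartialOrder A] [StarOrderedRing A] [Nontrivial A]
    {M : ℕ → StarSubalgebra ℂ A} (hM : Monotone M) (hdense : Dense (⋃ n, (M n : Set A)))
    (τ : StrongDual ℂ A) (h1 : τ 1 = 1) (hτ : ∀ x y, τ (x * y) = τ (y * x)) (S : StarSubalgebra ℂ A)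
    (hS : ∀ t, ∃ (γ : Type) (_ : Fintype γ) (_ : DecidableEq γ) (_ : Nonempty γ)
      (F : Matrix γ γ ℂ →⋆ₐ[ℂ] A), F.range ≤ S ∧ ∀ x ∈ M t, IsSelfAdjoint x →
        ∃ r : ℂ, ‖matrixAverage F x - r • 1‖ ≤ 1 / ((t : ℝ) + 1) * ‖x‖)
    (y : A) (ε : ℝ) (hε : 0 < ε) :
    ∃ (γ : Type) (_ : Fintype γ) (_ : DecidableEq γ) (F : Matrix γ γ ℂ →⋆ₐ[ℂ] A), F.range ≤ S ∧
      ‖matrixAverage F (star y * y) - τ (star y * y) • 1‖ < ε := by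
  set C := 1 + ‖τ‖ with hC
  have hC0 : 0 < C := by positivity
  have hτC : ∀ x, ‖τ x • (1 : A)‖ ≤ ‖τ‖ * ‖x‖ := by
    intro x
    rw [norm_smul, CStarRing.norm_one, mul_one]
    exact τ.le_opNorm x
  -- Averaging is contractive on self-adjoint elements, so subtracting the trace costs at most a
  -- factor `C`; two errors below `δ` add up to less than `ε`.
  set δ := ε / (2 * C) with hδ
  have hδ0 : 0 < δ := by positivity
  obtain ⟨w, hwδ, hw⟩ : ∃ w, ‖star y * y - star w * w‖ < δ ∧ w ∈ ⋃ n, (M n : Set A) := by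
    have hopen : IsOpen {w : A | ‖star y * y - star w * w‖ < δ} :=
      isOpen_lt (by fun_prop) continuous_const
    have hymem : y ∈ {w : A | ‖star y * y - star w * w‖ < δ} := by
      rw [Set.mem_ofPred_eq, sub_self, norm_zero]; exact hδ0
    exact hdense.inter_open_nonempty _ hopen ⟨y, hymem⟩
  obtain ⟨n, hw⟩ := Set.mem_iUnion.1 hw
  set x := star y * y with hx
  set z := star w * w with hz
  have hxsa : IsSelfAdjoint x := IsSelfAdjoint.star_mul_self y
  have hzsa : IsSelfAdjoint z := IsSelfAdjoint.star_mul_self w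
  obtain ⟨N, hN⟩ := exists_nat_gt (‖z‖ / δ)
  set t := max n N with ht
  have hzt : z ∈ M t := by
    have hwt : w ∈ M t := hM (le_max_left n N) hw
    exact mul_mem (star_mem hwt) hwt
  obtain ⟨γ, _, _, _, F, hFS, hF⟩ := hS t
  refine ⟨γ, inferInstance, inferInstance, F, hFS, ?_⟩
  obtain ⟨r, hr⟩ := hF z hzt hzsa
  have hr' : ‖matrixAverage F z - r • 1‖ < δ := by
    refine hr.trans_lt ?_
    have h2 : (N : ℝ) ≤ t := by exact_mod_cast le_max_right n N
    rw [one_div_mul_eq_div, div_lt_iff₀ (by positivity)]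
    rw [div_lt_iff₀ hδ0] at hN
    nlinarith
  set e := matrixAverage F z - r • 1 with he
  -- Averaging preserves the trace, so the unknown scalar `r` equals `τ z` up to `τ e`.
  have hτe : τ z = r + τ e := by
    have h2 : τ (matrixAverage F z) = τ z := tracial_matrixAverage F (τ : A →ₗ[ℂ] ℂ) hτ z
    rw [he, map_sub, h2, map_smul, h1, smul_eq_mul, mul_one, add_sub_cancel]
  have hdecomp : matrixAverage F x - τ x • 1
      = (matrixAverage F (x - z) - τ (x - z) • 1) + (e - τ e • 1) := by
    have h2 : e = matrixAverage F z - r • 1 := rfl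
    have h3 : τ (x - z) = τ x - (r + τ e) := by rw [map_sub, hτe]
    have h4 : matrixAverage F (x - z) = matrixAverage F x - matrixAverage F z := map_sub _ _ _
    rw [h3, h4]
    nth_rewrite 2 [h2]
    module
  rw [hdecomp]
  have b1 := norm_add_le (matrixAverage F (x - z) - τ (x - z) • 1) (e - τ e • (1 : A))
  have b2 := norm_sub_le (matrixAverage F (x - z)) (τ (x - z) • (1 : A))
  have b3 := norm_sub_le e (τ e • (1 : A))
  have b4 := norm_matrixAverage_le F (hxsa.sub hzsa)
  have b5 := hτC (x - z)
  have b6 := hτC e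
  have b7 : C * ‖x - z‖ < C * δ := mul_lt_mul_of_pos_left hwδ hC0
  have b8 : C * ‖e‖ < C * δ := mul_lt_mul_of_pos_left hr' hC0
  have b9 : C * δ + C * δ = ε := by rw [hδ]; field_simp; ring
  rw [hC] at b7 b8 b9
  linarith

end Irreducible

/-! ### Construction of the embedding -/

theorem mainTheorem6 {A B : Type*} [CStarAlgebra A] [PartialOrder A] [StarOrderedRing A]
    [CStarAlgebra B] (hA : IsUHF A) (hB : IsUHF B)
    (hBA : ∃ φ : B →⋆ₐ[ℂ] A, Function.Injective φ) :
    ∃ ι : B →⋆ₐ[ℂ] A, IsCStarIrreducible ι ∧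
      ∃ (M : ℕ → StarSubalgebra ℂ A) (N : ℕ → StarSubalgebra ℂ B),
        IsMatrixTower M ∧ IsMatrixTower N ∧
        (∀ n, (N n).map ι ≤ M n) ∧
        (∀ n, EverywhereNonOrthogonal (M n)
          (M (n + 1) ⊓ StarSubalgebra.centralizer ℂ (ι '' (N (n + 1) : Set B)))) := by
  obtain ⟨M, hM⟩ := hA
  obtain ⟨N, hN⟩ := hB
  obtain ⟨φ, -⟩ := hBA
  have := hM.nontrivial
  have := hN.nontrivial
  obtain ⟨a, G, ha, hG, hGr⟩ := hM.exists_starAlgHom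
  obtain ⟨b, H, hb, hH, hHr⟩ := hN.exists_starAlgHom
  have hane : ∀ n, Nonempty (Fin (a n)) := fun n => ⟨⟨0, ha n⟩⟩
  have hbne : ∀ n, Nonempty (Fin (b n)) := fun n => ⟨⟨0, hb n⟩⟩
  -- The given embedding enters only through this divisibility; `ι` is built afresh.
  have hdvd : ∀ n, ∃ m₀, ∀ m ≥ m₀, b n ∣ a m := by
    intro n
    obtain ⟨m₀, hm₀⟩ := hM.exists_card_dvd G ha hG hGr (φ.comp (H n))
    exact ⟨m₀, fun m hm => by simpa using hm₀ m hm⟩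
  have hbmono := hN.strictMono_card H hH hHr
  let State : Type _ := Σ' (m n : ℕ), {ψ : Matrix (Fin (b n)) (Fin (b n)) ℂ →⋆ₐ[ℂ] A //
    ∀ x, ψ x ∈ M m}
  have init : Nonempty State := by
    obtain ⟨m, hm⟩ := hdvd 0
    obtain ⟨d, hd⟩ := hm m le_rfl
    let g : Fin (a m) ≃ Fin (b 0) × Fin d := Fintype.equivOfCardEq (by simp [hd])
    refine ⟨⟨m, 0, (G m).comp (Matrix.amplifyReindex g), fun x => ?_⟩⟩
    rw [← hGr]
    exact ⟨_, rfl⟩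
  have step : ∀ (t : ℕ) (s : State), ∃ s' : State, s.1 < s'.1 ∧ s.2.1 < s'.2.1 ∧
      (∀ X X', H s'.2.1 X' = H s.2.1 X → s'.2.2.1 X' = s.2.2.1 X) ∧
      ∃ (γ : Type) (_ : Fintype γ) (_ : DecidableEq γ) (_ : Nonempty γ)
        (F : Matrix γ γ ℂ →⋆ₐ[ℂ] A) (bad : Finset γ), F.range = s'.2.2.1.range ∧
        bad.card * (t + 1) ≤ Fintype.card γ ∧
        ∀ x ∈ M s.1, ∃ y : γ → ℂ,
          (∀ c ∉ bad, F (Matrix.single c c 1) * x * F (Matrix.single c c 1)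
            = y c • F (Matrix.single c c 1)) ∧
          (x ≠ 0 → 0 ≤ x → ∃ c ∉ bad, y c ≠ 0) := by
    rintro t ⟨m, n, ψ, hψ⟩
    -- The sizes `b` increase strictly, so `b n' ≥ n' ≥ a m * (t + 1)`, which bounds the bad
    -- proportion by `1 / (t + 1)`.
    set n' := max (n + 1) (a m * (t + 1)) with hn'
    obtain ⟨m₀, hm₀⟩ := hdvd n'
    set m' := max (m + 1) m₀ with hm'
    have hmm' : m < m' := le_max_left (m + 1) m₀
    have hnn' : n < n' := le_max_left (n + 1) _
    obtain ⟨ψ', h1, h2, h3⟩ := exists_extension_step (G m) (G m') (H n) (H n') ψ (hG m) (hG m')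
      (hH n') (by rw [hGr]; exact hψ)
      (by rw [hGr, hGr]; exact hM.strictMono.monotone hmm'.le)
      (by rw [hHr, hHr]; exact hN.strictMono.monotone hnn'.le)
      (by simpa using hm₀ m' (le_max_right _ _)) (Nat.succ_pos t)
      (by simpa using (le_max_right (n + 1) (a m * (t + 1))).trans (hbmono.id_le n'))
    rw [hGr] at h1 h3
    exact ⟨⟨m', n', ψ', h1⟩, hmm', hnn', h2, h3⟩
  choose next hnext using step
  let s : ℕ → State := fun t => Nat.rec init.some (fun t s => next t s) t
  have hs : ∀ t, s (t + 1) = next t (s t) := fun t => rfl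
  have hm : StrictMono fun t => (s t).1 :=
    strictMono_nat_of_lt_succ fun t => (hnext t (s t)).1
  have hn : StrictMono fun t => (s t).2.1 :=
    strictMono_nat_of_lt_succ fun t => (hnext t (s t)).2.1
  have hcomp : ∀ t X X', H (s (t + 1)).2.1 X' = H (s t).2.1 X →
      (s (t + 1)).2.2.1 X' = (s t).2.2.1 X := fun t => (hnext t (s t)).2.2.1
  have hgood := fun t => (hnext t (s t)).2.2.2
  have hM' := hM.comp_strictMono hm
  have hN' := hN.comp_strictMono hn
  obtain ⟨ι, hιinj, hι⟩ := exists_starAlgHom_extending (fun t => hb _) (fun t => H (s t).2.1)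
    (fun t => (s t).2.2.1)
    (fun t => by rw [hHr, hHr]; exact hN'.strictMono.monotone (Nat.le_succ t))
    (by simp only [hHr]; exact hN'.dense) hcomp
  have hmemN : ∀ n x, x ∈ N n → ∃ X, H n X = x := by
    intro n x hx
    rw [← hHr] at hx
    exact hx
  obtain ⟨τ, h1, hτ⟩ := hM.exists_trace
  refine ⟨ι, ⟨hιinj, fun D _ hD => ?_⟩, _, _, hM', hN', ?_, ?_⟩
  · refine isSimpleCStar_of_norm_matrixAverage_sub_lt τ
      (fun y hy => tracial_star_mul_self_ne_zero hM h1 hτ hy) ι.range ?_ D hD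
    refine exists_norm_matrixAverage_sub_trace_lt hM'.strictMono.monotone hM'.dense τ h1 hτ
      ι.range fun t => ?_
    obtain ⟨γ, _, _, _, F, bad, hFr, hcard, hF⟩ := hgood t
    refine ⟨γ, inferInstance, inferInstance, inferInstance, F, ?_, fun x hx hxsa => ?_⟩
    · rw [hFr]
      rintro _ ⟨X, rfl⟩
      exact ⟨_, hι (t + 1) X⟩
    · obtain ⟨y, hy, -⟩ := hF x hx
      obtain ⟨r, hr⟩ := exists_norm_matrixAverage_sub_le F bad hxsa y hy
      refine ⟨r, hr.trans ?_⟩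
      gcongr ?_ * _
      rw [div_le_div_iff₀ (by exact_mod_cast Fintype.card_pos) (by positivity), one_mul]
      exact_mod_cast hcard
  · rintro t _ ⟨x, hx, rfl⟩
    obtain ⟨X, rfl⟩ := hmemN _ x hx
    change ι (H _ X) ∈ M _
    rw [hι t X]
    exact (s t).2.2.2 X
  · rintro t x hx z hz hx0 - hxne hzne hxz
    obtain ⟨γ, _, _, _, F, bad, hFr, -, hF⟩ := hgood t
    obtain ⟨y, hy, hy'⟩ := hF x hx
    obtain ⟨c, hc, hyc⟩ := hy' hxne hx0
    refine hzne (eq_zero_of_compress_ne_zero F hyc (hy c hc) (fun X => ?_) hxz)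
    -- The range of `F` is the image under `ι` of the next stage of `B`, so `z` in the commutant of
    -- that stage commutes with it.
    have hX : F X ∈ (s (t + 1)).2.2.1.range := by
      have : F X ∈ F.range := ⟨X, rfl⟩
      rw [hFr] at this
      exact this
    obtain ⟨Y, hY⟩ := hX
    replace hY : (s (t + 1)).2.2.1 Y = F X := hY
    rw [← hY, ← hι (t + 1) Y]
    refine ((StarSubalgebra.mem_centralizer_iff ℂ).1 hz.2 _ ⟨_, ?_, rfl⟩).1
    change H (s (t + 1)).2.1 Y ∈ N (s (t + 1)).2.1
    rw [← hHr]
    exact ⟨Y, rfl⟩
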